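/- Let $(M,g)$ be a smooth four-dimensional spherically symmetric spacetime of signature $(-,+,+,+)$, i.e. the rotation group acts by isometries with spacelike two-spheres (the shells) as orbits; centres, where the orbit degenerates, are excluded. Let $u^a$ be a smooth rotation-invariant unit timelike vector field and $e^a$ a smooth rotation-invariant unit spacelike vector field orthogonal to $u^a$. Put $h_{ab}=g_{ab}+u_au_b$ and $N_{ab}=h_{ab}-e_ae_b$, let $D_a$ be the covariant derivative totally projected with $h$, and write $\dot f=u^a\nabla_af$ and $\hat f=e^aD_af=e^a\nabla_af$ for scalars $f$. Let $$\mathcal A=e^bu^a\nabla_au_b,\quad \Theta=h^{ab}D_au_b,\quad \Sigma=\sigma_{ab}e^ae^b\ \text{ with }\ \sigma_{ab}=D_{(a}u_{b)}-\tfrac13\Theta h_{ab},\quad \phi=N^{ab}D_ae_b,$$ so that $\nabla_au_b=-\mathcal A\,u_ae_b+\tfrac13\Theta h_{ab}+\Sigma(e_ae_b-\tfrac12N_{ab})$ and $D_ae_b=\tfrac12\phi N_{ab}$. Let $T_{ab}=G_{ab}$ be the effective energy-momentum tensor (Einstein's equations with $8\pi G=c=1$, any cosmological term being contained in $T_{ab}$),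 and let $\mu=T_{ab}u^au^b$, $p=\tfrac13h^{ab}T_{ab}$ and $\Pi=\pi_{ab}e^ae^b$, where $\pi_{ab}$ is the symmetric trace-free part of $T_{ab}$ projected with $h$. Let $K$ be the Gaussian curvature of the shells (${}^2R_{ab}=KN_{ab}$ for the induced metric), $C=1/\sqrt K$ their area radius, $\mathcal M=\tfrac C2(1-\nabla_aC\nabla^aC)$ the Misner–Sharp mass, and $\Psi=\Sigma-\tfrac23\Theta$. Then $K$, $\Psi$ and $\phi$ are smooth, $K>0$, and $$\dot K=\left(\Sigma-\tfrac23\Theta\right)K,\qquad \hat K=-\phi K .$$ Moreover $K$ satisfies the closed hyperbolic equation $$\ddot K-\hat{\hat K}+\mathcal F K=0,\qquad \mathcal F=-\left[\dot\Psi+\Psi^2+\hat\phi-\phi^2\right],$$ and the restoration factor is $$\mathcal F=6K-16\mathcal M K^{3/2}+\Psi^2+\Psi\Theta+\mathcal A\phi+\mu-p-\Pi .$$ -/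

import Mathlib

open scoped ContDiff

namespace SphericalSpacetime

noncomputable section

/-- Coordinate space of dimension `n`. -/
abbrev Coord (n : ℕ) := Fin n → ℝ

/-- A field of `n × n` components over a coordinate patch (a metric or another covariant 2-tensor). -/
abbrev TensorField (n : ℕ) := Coord n → Matrix (Fin n) (Fin n) ℝ

/-- The components `vᵃ` (or `w_a`) of a vector (or covector) field over a coordinate patch. -/
abbrev VecField (n : ℕ) := Coord n → Fin n → ℝ

/-- The partial derivative `∂_a f` at `x`. -/
def pd {n : ℕ} (a : Fin n) (f : Coord n → ℝ) (x : Coord n) : ℝ :=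
  fderiv ℝ f x (Pi.single a 1)

/-! ### Tensor calculus of a metric in coordinates, in any dimension -/

/-- Christoffel symbols `Γᵃ_bc` of the Levi-Civita connection. -/
def christoffel {n : ℕ} (g : TensorField n) (a b c : Fin n) (x : Coord n) : ℝ :=
  (1 / 2) * ∑ d, (g x)⁻¹ a d *
    (pd b (fun y => g y d c) x + pd c (fun y => g y d b) x - pd d (fun y => g y b c) x)

/-- Riemann tensor
`Rᵃ_bcd = ∂_c Γᵃ_db - ∂_d Γᵃ_cb + Γᵃ_ce Γᵉ_db - Γᵃ_de Γᵉ_cb`. -/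
def riemann {n : ℕ} (g : TensorField n) (a b c d : Fin n) (x : Coord n) : ℝ :=
  pd c (christoffel g a d b) x - pd d (christoffel g a c b) x
    + ∑ k, (christoffel g a c k x * christoffel g k d b x
        - christoffel g a d k x * christoffel g k c b x)

/-- Ricci tensor `R_bd = Rᵃ_bad`. -/
def ricci {n : ℕ} (g : TensorField n) (x : Coord n) (b d : Fin n) : ℝ :=
  ∑ a, riemann g a b a d x

/-- Ricci scalar `R = gᵃᵇ R_ab`. -/
def scalarCurvature {n : ℕ} (g : TensorField n) (x : Coord n) : ℝ :=
  ∑ a, ∑ b, (g x)⁻¹ a b * ricci g x a b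

/-- Einstein tensor `G_ab = R_ab - (1/2) R g_ab`. -/
def einstein {n : ℕ} (g : TensorField n) (x : Coord n) (a b : Fin n) : ℝ :=
  ricci g x a b - (1 / 2) * scalarCurvature g x * g x a b

/-- Lowering an index: `v_a = g_ab vᵇ`. -/
def lower {n : ℕ} (g : TensorField n) (v : VecField n) : VecField n :=
  fun x a => ∑ b, g x a b * v x b

/-- Covariant derivative of a covector field: `∇_a w_b = ∂_a w_b - Γᶜ_ab w_c`. -/
def covDeriv {n : ℕ} (g : TensorField n) (w : VecField n) (x : Coord n) (a b : Fin n) : ℝ :=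
  pd a (fun y => w y b) x - ∑ c, christoffel g c a b x * w x c

/-- The scalar product `g_ab vᵃ wᵇ`. -/
def innerProd {n : ℕ} (g : TensorField n) (v w : VecField n) (x : Coord n) : ℝ :=
  ∑ a, ∑ b, g x a b * v x a * w x b

/-- Derivative of a scalar along a vector field, `vᵃ ∇_a f`. For `v = u` this is the dot derivative;
for `v = e` it is the hat derivative `eᵃ D_a f`, because `e` is orthogonal to `u`. -/
def along {n : ℕ} (v : VecField n) (f : Coord n → ℝ) (x : Coord n) : ℝ :=
  ∑ a, v x a * pd a f x

/-- Lie derivative of a covariant 2-tensor,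
`(L_ξ g)_ab = ξᶜ ∂_c g_ab + g_cb ∂_a ξᶜ + g_ac ∂_b ξᶜ`. -/
def lieMetric {n : ℕ} (ξ : VecField n) (g : TensorField n) (x : Coord n) (a b : Fin n) : ℝ :=
  ∑ c, (ξ x c * pd c (fun y => g y a b) x
    + g x c b * pd a (fun y => ξ y c) x + g x a c * pd b (fun y => ξ y c) x)

/-- Lie derivative of a vector field, `(L_ξ v)ᵃ = ξᶜ ∂_c vᵃ - vᶜ ∂_c ξᵃ`. -/
def lieVec {n : ℕ} (ξ v : VecField n) (x : Coord n) (a : Fin n) : ℝ :=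
  ∑ c, (ξ x c * pd c (fun y => v y a) x - v x c * pd c (fun y => ξ y a) x)

/-! ### Spherically symmetric spacetimes

Coordinates are `x = (x⁰, x¹, θ, ϕ)`: the pair `(x⁰, x¹)` labels the spherical shell (the orbit of
the rotation group), and `(θ, ϕ)` are standard polar coordinates on it, the rotation group acting
on each shell in the standard way. -/

/-- A smooth Lorentzian metric of signature `(-,+,+,+)` on `U`. -/
structure IsLorentzMetric (U : Set (Coord 4)) (g : TensorField 4) : Prop where
  smooth : ∀ a b, ContDiffOn ℝ ∞ (fun x => g x a b) U
  symm : ∀ x ∈ U, (g x).IsSymm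
  signature : ∀ x ∈ U, ∃ P : Matrix (Fin 4) (Fin 4) ℝ,
    IsUnit P.det ∧ P.transpose * g x * P = Matrix.diagonal ![-1, 1, 1, 1]

/-- The generators of the rotation group in polar coordinates:
`- sin ϕ ∂_θ - cot θ cos ϕ ∂_ϕ`, `cos ϕ ∂_θ - cot θ sin ϕ ∂_ϕ` and `∂_ϕ`. -/
def rotation (i : Fin 3) : VecField 4 := fun x =>
  ![![0, 0, -Real.sin (x 3), -(Real.cos (x 2) / Real.sin (x 2)) * Real.cos (x 3)],
    ![0, 0, Real.cos (x 3), -(Real.cos (x 2) / Real.sin (x 2)) * Real.sin (x 3)],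
    ![0, 0, 0, 1]] i

/-- The metric is invariant under rotations: the three generators are Killing vector fields. -/
def RotationInvariantMetric (U : Set (Coord 4)) (g : TensorField 4) : Prop :=
  ∀ i, ∀ x ∈ U, ∀ a b, lieMetric (rotation i) g x a b = 0

/-- A vector field is invariant under rotations. -/
def RotationInvariantVec (U : Set (Coord 4)) (v : VecField 4) : Prop :=
  ∀ i, ∀ x ∈ U, ∀ a, lieVec (rotation i) v x a = 0

/-- A spherically symmetric spacetime (on a patch `U` of polar coordinates) with its 1+1+2 frame:
a unit timelike field `u` and a unit spacelike field `e` orthogonal to it, both compatible with the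
symmetry. -/
structure IsSphericallySymmetric (U : Set (Coord 4)) (g : TensorField 4) (u e : VecField 4) :
    Prop where
  isOpen : IsOpen U
  polar : ∀ x ∈ U, 0 < x 2 ∧ x 2 < Real.pi
  lorentz : IsLorentzMetric U g
  invariant_metric : RotationInvariantMetric U g
  smooth_u : ∀ a, ContDiffOn ℝ ∞ (fun x => u x a) U
  smooth_e : ∀ a, ContDiffOn ℝ ∞ (fun x => e x a) U
  invariant_u : RotationInvariantVec U u
  invariant_e : RotationInvariantVec U e
  unit_u : ∀ x ∈ U, innerProd g u u x = -1
  unit_e : ∀ x ∈ U, innerProd g e e x = 1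
  orthogonal : ∀ x ∈ U, innerProd g u e x = 0

/-- Einstein's field equations `G_ab = T_ab` in units with `8πG = c = 1`, `T` being the effective
energy-momentum tensor (it contains any cosmological term). -/
def EinsteinEquations (U : Set (Coord 4)) (g T : TensorField 4) : Prop :=
  ∀ x ∈ U, ∀ a b, einstein g x a b = T x a b

/-! ### The 1+1+2 scalars -/

/-- `h_ab = g_ab + u_a u_b`. -/
def hLow (g : TensorField 4) (u : VecField 4) (x : Coord 4) (a b : Fin 4) : ℝ :=
  g x a b + lower g u x a * lower g u x b

/-- `hᵃᵇ = gᵃᵇ + uᵃ uᵇ`. -/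
def hUp (g : TensorField 4) (u : VecField 4) (x : Coord 4) (a b : Fin 4) : ℝ :=
  (g x)⁻¹ a b + u x a * u x b

/-- `hᵃ_b = δᵃ_b + uᵃ u_b`. -/
def hMix (g : TensorField 4) (u : VecField 4) (x : Coord 4) (a b : Fin 4) : ℝ :=
  (if a = b then 1 else 0) + u x a * lower g u x b

/-- `Nᵃᵇ = gᵃᵇ + uᵃ uᵇ - eᵃ eᵇ`. -/
def sheetUp (g : TensorField 4) (u e : VecField 4) (x : Coord 4) (a b : Fin 4) : ℝ :=
  hUp g u x a b - e x a * e x b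

/-- Fully projected spatial derivative `D_a w_b = hᶜ_a hᵈ_b ∇_c w_d`. -/
def spatialDeriv (g : TensorField 4) (u w : VecField 4) (x : Coord 4) (a b : Fin 4) : ℝ :=
  ∑ c, ∑ d, hMix g u x c a * hMix g u x d b * covDeriv g w x c d

/-- Acceleration scalar `𝒜 = A_b eᵇ` with `A_b = uᵃ ∇_a u_b`. -/
def acceleration (g : TensorField 4) (u e : VecField 4) (x : Coord 4) : ℝ :=
  ∑ b, (∑ a, u x a * covDeriv g (lower g u) x a b) * e x b

/-- Expansion `Θ = hᵃᵇ D_a u_b`. -/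
def expansion (g : TensorField 4) (u : VecField 4) (x : Coord 4) : ℝ :=
  ∑ a, ∑ b, hUp g u x a b * spatialDeriv g u (lower g u) x a b

/-- Shear tensor `σ_ab = D_(a u_b) - (1/3) Θ h_ab`. -/
def shearTensor (g : TensorField 4) (u : VecField 4) (x : Coord 4) (a b : Fin 4) : ℝ :=
  (spatialDeriv g u (lower g u) x a b + spatialDeriv g u (lower g u) x b a) / 2
    - (1 / 3) * expansion g u x * hLow g u x a b

/-- Shear scalar `Σ = σ_ab eᵃ eᵇ`, the coefficient in `σ_ab = Σ (e_a e_b - (1/2) N_ab)`. -/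
def shear (g : TensorField 4) (u e : VecField 4) (x : Coord 4) : ℝ :=
  ∑ a, ∑ b, shearTensor g u x a b * e x a * e x b

/-- Sheet expansion `φ = Nᵃᵇ D_a e_b`, the coefficient in `D_a e_b = (1/2) φ N_ab`. -/
def sheetExpansion (g : TensorField 4) (u e : VecField 4) (x : Coord 4) : ℝ :=
  ∑ a, ∑ b, sheetUp g u e x a b * spatialDeriv g u (lower g e) x a b

/-- Energy density `μ = T_ab uᵃ uᵇ`. -/
def energyDensity (T : TensorField 4) (u : VecField 4) (x : Coord 4) : ℝ :=
  ∑ a, ∑ b, T x a b * u x a * u x b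

/-- Isotropic pressure `p = (1/3) hᵃᵇ T_ab`. -/
def pressure (g T : TensorField 4) (u : VecField 4) (x : Coord 4) : ℝ :=
  (1 / 3) * ∑ a, ∑ b, hUp g u x a b * T x a b

/-- Anisotropic stress `π_ab = hᶜ_(a hᵈ_b) T_cd - p h_ab`. -/
def anisotropicStress (g T : TensorField 4) (u : VecField 4) (x : Coord 4) (a b : Fin 4) : ℝ :=
  (∑ c, ∑ d, hMix g u x c a * hMix g u x d b * ((T x c d + T x d c) / 2))
    - pressure g T u x * hLow g u x a b

/-- Anisotropic pressure scalar `Π = π_ab eᵃ eᵇ`, the coefficient in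
`π_ab = Π (e_a e_b - (1/2) N_ab)`. -/
def anisotropicPressure (g T : TensorField 4) (u e : VecField 4) (x : Coord 4) : ℝ :=
  ∑ a, ∑ b, anisotropicStress g T u x a b * e x a * e x b

/-- `Ψ = Σ - (2/3) Θ`. -/
def Psi (g : TensorField 4) (u e : VecField 4) (x : Coord 4) : ℝ :=
  shear g u e x - (2 / 3) * expansion g u x

/-! ### Gaussian curvature of the shells, Misner–Sharp mass, restoration factor -/

/-- The metric induced on the shell through `x`, in its coordinates `(θ, ϕ)`. -/
def shellMetric (g : TensorField 4) (x : Coord 4) : TensorField 2 := fun y =>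
  (g ![x 0, x 1, y 0, y 1]).submatrix ![2, 3] ![2, 3]

/-- Gaussian curvature at `x` of the shell through `x`: half the Ricci scalar of the induced metric,
that is, the trace of the defining relation `²R_ab = K N_ab`. -/
def gaussCurvature (g : TensorField 4) (x : Coord 4) : ℝ :=
  (1 / 2) * scalarCurvature (shellMetric g x) ![x 2, x 3]

/-- Area radius `C = 1 / √K` of the shells. -/
def areaRadius (g : TensorField 4) (x : Coord 4) : ℝ :=
  1 / Real.sqrt (gaussCurvature g x)

/-- Misner–Sharp mass `(C / 2) (1 - ∇_a C ∇ᵃ C)`. -/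
def misnerSharpMass (g : TensorField 4) (x : Coord 4) : ℝ :=
  areaRadius g x / 2 *
    (1 - ∑ a, ∑ b, (g x)⁻¹ a b * pd a (areaRadius g) x * pd b (areaRadius g) x)

/-- The restoration factor `-[Ψ̇ + Ψ² + φ̂ - φ²]`. -/
def restorationFactor (g : TensorField 4) (u e : VecField 4) (x : Coord 4) : ℝ :=
  -(along u (Psi g u e) x + Psi g u e x ^ 2
    + along e (sheetExpansion g u e) x - sheetExpansion g u e x ^ 2)

end

end SphericalSpacetime

open SphericalSpacetime

/-!
Invariance under the rotation generators forces `g = γ + q (dθ² + sin² θ dϕ²)`, with `γ` and `q`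
functions of the shell only and `u`, `e` tangent to the `γ` directions. The shells are then round
spheres of radius `√q`, so `K = 1 / q`, and everything is expressed through derivatives of `q`.

The 1+1+2 scalars `φ` and `-Ψ` are the traces over the shell of `∇e` and `∇u`, that is, `q̂ / q` and
`q̇ / q`; this gives the two propagation equations, whose iteration is the wave equation. For the
restoration factor, Einstein's equations identify `μ - p - Π` with the trace `Nᵃᵇ R_ab` over the
shell, which for a warped metric equals `(2 - □q + |∇q|² / q) / q`. Here `|∇q|² = q² (φ² - Ψ²)`
carries the Misner–Sharp mass, and `□q` is the divergence of `∇q = -q̇ u + q̂ e`, evaluated with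
`div u = Θ` and `div e = 𝒜 + φ`.
-/

namespace SphericalSpacetime

open Real (sin cos)

section PartialDerivatives

variable {n : ℕ} {U : Set (Coord n)} {x : Coord n} {f h : Coord n → ℝ}

theorem pd_congr (hU : IsOpen U) (hfh : Set.EqOn f h U) (hx : x ∈ U) (a : Fin n) :
    pd a f x = pd a h x := by
  rw [pd, pd, (hfh.eventuallyEq_of_mem (hU.mem_nhds hx)).fderiv_eq]

theorem pd_const (c : ℝ) (a : Fin n) : pd a (fun _ => c) x = 0 := by
  simp [pd]

theorem pd_eq_zero (hU : IsOpen U) {c : ℝ} (hf : ∀ y ∈ U, f y = c) (hx : x ∈ U) (a : Fin n) :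
    pd a f x = 0 := by
  rw [pd_congr hU hf hx, pd_const]

theorem pd_add (hf : DifferentiableAt ℝ f x) (hh : DifferentiableAt ℝ h x) (a : Fin n) :
    pd a (fun y => f y + h y) x = pd a f x + pd a h x := by
  simp [pd, fderiv_fun_add hf hh]

theorem pd_neg (a : Fin n) : pd a (fun y => -f y) x = -pd a f x := by
  simp [pd, fderiv_fun_neg]

theorem pd_mul (hf : DifferentiableAt ℝ f x) (hh : DifferentiableAt ℝ h x) (a : Fin n) :
    pd a (fun y => f y * h y) x = f x * pd a h x + pd a f x * h x := by
  simp [pd, fderiv_fun_mul hf hh, mul_comm]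

theorem pd_sum {ι : Type*} {s : Finset ι} {F : ι → Coord n → ℝ}
    (hF : ∀ i ∈ s, DifferentiableAt ℝ (F i) x) (a : Fin n) :
    pd a (fun y => ∑ i ∈ s, F i y) x = ∑ i ∈ s, pd a (F i) x := by
  rw [pd, fderiv_fun_sum hF, sum_apply]
  rfl

theorem pd_comp {F : ℝ → ℝ} {F' : ℝ} (hF : HasDerivAt F F' (f x)) (hf : DifferentiableAt ℝ f x)
    (a : Fin n) : pd a (fun y => F (f y)) x = F' * pd a f x := by
  have hFf : fderiv ℝ (fun y => F (f y)) x = F' • fderiv ℝ f x :=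
    (hF.comp_hasFDerivAt x hf.hasFDerivAt).fderiv
  simp [pd, hFf]

theorem pd_coord (i a : Fin n) : pd a (fun y => y i) x = if a = i then 1 else 0 := by
  have hproj : fderiv ℝ (fun y : Coord n => y i) x = ContinuousLinearMap.proj i :=
    (hasFDerivAt_apply i x).fderiv
  simp [pd, hproj, Pi.single_apply, eq_comm]

theorem pd_comp_coord {F : ℝ → ℝ} {F' : ℝ} {i : Fin n} (hF : HasDerivAt F F' (x i)) (a : Fin n) :
    pd a (fun y => F (y i)) x = if a = i then F' else 0 := by
  rw [pd_comp (f := fun y => y i) hF (by fun_prop), pd_coord, mul_ite, mul_one, mul_zero]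

theorem hasDerivAt_cos_div_sin {t : ℝ} (ht : sin t ≠ 0) :
    HasDerivAt (fun t => cos t / sin t) (-(1 / sin t ^ 2)) t := by
  refine ((Real.hasDerivAt_cos t).div (Real.hasDerivAt_sin t) ht).congr_deriv ?_
  rw [← neg_div, ← Real.sin_sq_add_cos_sq t]
  ring

theorem differentiableAt_of_contDiffOn (hU : IsOpen U) (hf : ContDiffOn ℝ ∞ f U) (hx : x ∈ U) :
    DifferentiableAt ℝ f x :=
  (hf.contDiffAt (hU.mem_nhds hx)).differentiableAt (by simp)

theorem contDiffOn_pd (hU : IsOpen U) (hf : ContDiffOn ℝ ∞ f U) (a : Fin n) :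
    ContDiffOn ℝ ∞ (pd a f) U :=
  (hf.fderiv_of_isOpen hU (by simp)).clm_apply contDiffOn_const

theorem contDiffOn_along (hU : IsOpen U) {v : VecField n}
    (hv : ∀ a, ContDiffOn ℝ ∞ (fun y => v y a) U) (hf : ContDiffOn ℝ ∞ f U) :
    ContDiffOn ℝ ∞ (along v f) U :=
  ContDiffOn.sum fun a _ => (hv a).mul (contDiffOn_pd hU hf a)

theorem along_congr (hU : IsOpen U) (hfh : Set.EqOn f h U) (hx : x ∈ U) (v : VecField n) :
    along v f x = along v h x := by
  simp only [along, pd_congr hU hfh hx]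

theorem along_neg (v : VecField n) : along v (fun y => -f y) x = -along v f x := by
  simp only [along, pd_neg, mul_neg, Finset.sum_neg_distrib]

theorem along_mul (hf : DifferentiableAt ℝ f x) (hh : DifferentiableAt ℝ h x) (v : VecField n) :
    along v (fun y => f y * h y) x = f x * along v h x + along v f x * h x := by
  simp only [along, pd_mul hf hh, Finset.mul_sum, Finset.sum_mul, ← Finset.sum_add_distrib]
  exact Finset.sum_congr rfl fun a _ => by ring

theorem along_single (i : Fin n) : along (fun _ => Pi.single i 1) f x = pd i f x := by
  simp only [along, Pi.single_apply, ite_mul, one_mul, zero_mul, Finset.sum_ite_eq',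
    Finset.mem_univ, if_true]

theorem along_along_of_along_eq_mul {v : VecField n} {k : Coord n → ℝ}
    (hU : IsOpen U) (hk : DifferentiableAt ℝ k x) (hf : DifferentiableAt ℝ f x)
    (hv : ∀ y ∈ U, along v f y = k y * f y) (hx : x ∈ U) :
    along v (along v f) x = (along v k x + k x ^ 2) * f x := by
  rw [along_congr hU hv hx, along_mul hk hf, hv x hx]
  ring

theorem along_comp {F : ℝ → ℝ} {F' : ℝ} (hF : HasDerivAt F F' (f x)) (hf : DifferentiableAt ℝ f x)
    (v : VecField n) : along v (fun y => F (f y)) x = F' * along v f x := by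
  simp only [along, pd_comp hF hf, Finset.mul_sum, mul_left_comm F']

theorem along_comp_coord {F : ℝ → ℝ} {F' : ℝ} {i : Fin n} (hF : HasDerivAt F F' (x i))
    (v : VecField n) : along v (fun y => F (y i)) x = v x i * F' := by
  simp only [along, pd_comp_coord hF, mul_ite, mul_zero, Finset.sum_ite_eq', Finset.mem_univ,
    if_true]

end PartialDerivatives

section SmoothInverse

variable {E ι : Type*} [NormedAddCommGroup E] [NormedSpace ℝ E] [Fintype ι] [DecidableEq ι]
  {s : Set E} {A : E → Matrix ι ι ℝ} {k : WithTop ℕ∞}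

theorem contDiffOn_det (hA : ∀ i j, ContDiffOn ℝ k (fun y => A y i j) s) :
    ContDiffOn ℝ k (fun y => (A y).det) s := by
  simp only [Matrix.det_apply']
  exact ContDiffOn.sum fun σ _ => contDiffOn_const.mul (contDiffOn_prod fun i _ => hA _ _)

theorem contDiffOn_inv_apply (hA : ∀ i j, ContDiffOn ℝ k (fun y => A y i j) s)
    (hdet : ∀ y ∈ s, IsUnit (A y).det) (i j : ι) : ContDiffOn ℝ k (fun y => (A y)⁻¹ i j) s := by
  simp only [Matrix.inv_def, Ring.inverse_eq_inv', Matrix.smul_apply, Matrix.adjugate_apply,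
    smul_eq_mul]
  refine ((contDiffOn_det hA).inv fun y hy => (hdet y hy).ne_zero).mul
    (contDiffOn_det fun k l => ?_)
  by_cases hk : k = j
  · simpa only [hk, Matrix.updateRow_self] using contDiffOn_const
  · simpa only [Matrix.updateRow_ne hk] using hA k l

end SmoothInverse

section LeviCivita

variable {n : ℕ} {U : Set (Coord n)} {x : Coord n} {g : TensorField n} {v w : VecField n}
  {f : Coord n → ℝ}

/-- The covariant derivative `∇_a vᵇ = ∂_a vᵇ + Γᵇ_ac vᶜ` of a vector field. -/
noncomputable def vecCovDeriv (g : TensorField n) (v : VecField n) (x : Coord n) (a b : Fin n) :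
    ℝ :=
  pd a (fun y => v y b) x + ∑ c, christoffel g b a c x * v x c

/-- The divergence `∇_a vᵃ`. -/
noncomputable def divergence (g : TensorField n) (v : VecField n) (x : Coord n) : ℝ :=
  ∑ a, vecCovDeriv g v x a a

/-- The gradient `∇ᵃ f`, as a vector field. The wave operator applied to `f` is
`divergence g (gradient g f)`, and `∇_a f ∇ᵃ f` is `along (gradient g f) f`. -/
noncomputable def gradient (g : TensorField n) (f : Coord n → ℝ) : VecField n :=
  fun x a => ∑ b, (g x)⁻¹ a b * pd b f x

/-- The contraction `S_ab vᵃ wᵇ` of a 2-tensor with two vectors. -/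
noncomputable def contraction (S : Fin n → Fin n → ℝ) (v w : Fin n → ℝ) : ℝ :=
  ∑ a, ∑ b, S a b * v a * w b

theorem contraction_symmetrization (S : Fin n → Fin n → ℝ) (v : Fin n → ℝ) :
    contraction (fun a b => (S a b + S b a) / 2) v v = contraction S v v := by
  have hswap : ∑ a, ∑ b, S b a * v a * v b = contraction S v v := by
    rw [Finset.sum_comm]
    simp only [contraction, mul_right_comm]
  calc contraction (fun a b => (S a b + S b a) / 2) v v
      = (contraction S v v + ∑ a, ∑ b, S b a * v a * v b) / 2 := by
        simp only [contraction, add_mul, add_div, div_mul_eq_mul_div, Finset.sum_add_distrib,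
          Finset.sum_div]
    _ = contraction S v v := by rw [hswap, add_self_div_two]

theorem contraction_single (S : Fin n → Fin n → ℝ) (i j : Fin n) :
    contraction S (Pi.single i 1) (Pi.single j 1) = S i j := by
  simp only [contraction, Pi.single_apply, mul_ite, mul_one, mul_zero, Finset.sum_ite_eq',
    Finset.mem_univ, if_true]

theorem divergence_congr (hU : IsOpen U) (hvw : Set.EqOn v w U) (hx : x ∈ U) :
    divergence g v x = divergence g w x := by
  have hpd (a : Fin n) : pd a (fun y => v y a) x = pd a (fun y => w y a) x :=
    pd_congr hU (fun y hy => congrFun (hvw hy) a) hx a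
  simp only [divergence, vecCovDeriv, hpd, hvw hx]

theorem divergence_add (hv : ∀ a, DifferentiableAt ℝ (fun y => v y a) x)
    (hw : ∀ a, DifferentiableAt ℝ (fun y => w y a) x) :
    divergence g (fun y a => v y a + w y a) x = divergence g v x + divergence g w x := by
  simp only [divergence, vecCovDeriv, ← Finset.sum_add_distrib]
  refine Finset.sum_congr rfl fun a _ => ?_
  rw [pd_add (hv a) (hw a), add_add_add_comm, ← Finset.sum_add_distrib]
  simp only [mul_add]

theorem divergence_mul (hf : DifferentiableAt ℝ f x)
    (hv : ∀ a, DifferentiableAt ℝ (fun y => v y a) x) :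
    divergence g (fun y a => f y * v y a) x = f x * divergence g v x + along v f x := by
  simp only [divergence, vecCovDeriv, along, Finset.mul_sum, ← Finset.sum_add_distrib]
  refine Finset.sum_congr rfl fun a _ => ?_
  rw [pd_mul hf (hv a), mul_add, Finset.mul_sum]
  simp only [mul_left_comm (f x)]
  ring

theorem divergence_const_mul (c : ℝ) (hv : ∀ a, DifferentiableAt ℝ (fun y => v y a) x) :
    divergence g (fun y a => c * v y a) x = c * divergence g v x := by
  simp only [divergence_mul (differentiableAt_const c) hv, along, pd_const, mul_zero,
    Finset.sum_const_zero, add_zero]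

theorem ricci_eq_divergence_sub (x : Coord n) (b d : Fin n) :
    ricci g x b d = divergence g (fun y a => christoffel g a d b y) x
      - ∑ a, pd d (christoffel g a a b) x
      - ∑ a, ∑ c, christoffel g a d c x * christoffel g c a b x := by
  simp only [ricci, riemann, divergence, vecCovDeriv, ← Finset.sum_sub_distrib]
  refine Finset.sum_congr rfl fun a _ => ?_
  rw [Finset.sum_sub_distrib]
  ring

theorem innerProd_eq_sum_mul_lower : innerProd g v w x = ∑ a, v x a * lower g w x a := by
  simp only [innerProd, lower, Finset.mul_sum]
  exact Finset.sum_congr rfl fun a _ => Finset.sum_congr rfl fun b _ => by ring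

theorem innerProd_comm (hg : (g x).IsSymm) :
    innerProd g v w x = innerProd g w v x := by
  unfold innerProd
  rw [Finset.sum_comm]
  refine Finset.sum_congr rfl fun a _ => Finset.sum_congr rfl fun b _ => ?_
  rw [hg.apply a b]
  ring

theorem innerProd_single (v : VecField n) (i : Fin n) :
    innerProd g v (fun _ => Pi.single i 1) x = ∑ a, v x a * g x a i := by
  simp only [innerProd, Pi.single_apply, mul_ite, mul_one, mul_zero, Finset.sum_ite_eq',
    Finset.mem_univ, if_true, mul_comm]

theorem contraction_einstein (v : VecField n) :
    contraction (einstein g x) (v x) (v x) = contraction (ricci g x) (v x) (v x)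
      - 1 / 2 * scalarCurvature g x * innerProd g v v x := by
  simp only [contraction, einstein, innerProd, sub_mul, Finset.sum_sub_distrib, Finset.mul_sum,
    mul_assoc]

section OrthogonalFrame

variable {E : Fin n → VecField n} {d : Fin n → ℝ}
  (hE : ∀ i j, innerProd g (E i) (E j) x = if i = j then d i else 0) (hd : ∀ i, d i ≠ 0)
include hE hd

theorem inv_eq_sum_of_orthogonal (a b : Fin n) : (g x)⁻¹ a b = ∑ i, E i x a * E i x b / d i := by
  let F : Matrix (Fin n) (Fin n) ℝ := Matrix.of fun i a => E i x a
  have hgram : F * g x * F.transpose = Matrix.diagonal d := by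
    ext i j
    rw [Matrix.diagonal_apply, ← hE]
    simp only [F, innerProd, Matrix.mul_apply, Matrix.transpose_apply, Matrix.of_apply,
      Finset.sum_mul]
    rw [Finset.sum_comm]
    exact Finset.sum_congr rfl fun a _ => Finset.sum_congr rfl fun b _ => by ring
  have hone : Matrix.diagonal d⁻¹ * F * g x * F.transpose = 1 := by
    rw [Matrix.mul_assoc, Matrix.mul_assoc, ← Matrix.mul_assoc F, hgram,
      Matrix.diagonal_mul_diagonal, ← Matrix.diagonal_one]
    exact congrArg _ (funext fun i => inv_mul_cancel₀ (hd i))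
  have hinv : (g x)⁻¹ = F.transpose * (Matrix.diagonal d⁻¹ * F) :=
    Matrix.inv_eq_left_inv (by rw [Matrix.mul_assoc]; exact mul_eq_one_comm.mp hone)
  rw [hinv, Matrix.mul_apply]
  refine Finset.sum_congr rfl fun i _ => ?_
  simp only [F, Matrix.diagonal_mul, Matrix.transpose_apply, Matrix.of_apply, Pi.inv_apply]
  ring

theorem sum_inv_mul_eq_sum_of_orthogonal (S : Fin n → Fin n → ℝ) :
    ∑ a, ∑ b, (g x)⁻¹ a b * S a b = ∑ i, contraction S (E i x) (E i x) / d i := by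
  simp only [inv_eq_sum_of_orthogonal hE hd, contraction, Finset.sum_mul, Finset.sum_div]
  rw [Finset.sum_comm_cycle]
  exact Finset.sum_congr rfl fun i _ => Finset.sum_congr rfl fun a _ =>
    Finset.sum_congr rfl fun b _ => by ring

theorem gradient_eq_sum_of_orthogonal (a : Fin n) :
    gradient g f x a = ∑ i, along (E i) f x / d i * E i x a := by
  simp only [gradient, along, inv_eq_sum_of_orthogonal hE hd, Finset.sum_mul, Finset.sum_div]
  rw [Finset.sum_comm]
  exact Finset.sum_congr rfl fun i _ => Finset.sum_congr rfl fun b _ => by ring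

end OrthogonalFrame

/-- A smooth nondegenerate metric, of any dimension and signature, on an open coordinate patch:
the setting of the Levi-Civita calculus. -/
structure IsPseudoRiemannian (U : Set (Coord n)) (g : TensorField n) : Prop where
  isOpen : IsOpen U
  smooth : ∀ a b, ContDiffOn ℝ ∞ (fun y => g y a b) U
  symm : ∀ y ∈ U, (g y).IsSymm
  isUnit_det : ∀ y ∈ U, IsUnit (g y).det

namespace IsPseudoRiemannian

theorem differentiableAt (h : IsPseudoRiemannian U g) (hx : x ∈ U) (a b : Fin n) :
    DifferentiableAt ℝ (fun y => g y a b) x :=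
  differentiableAt_of_contDiffOn h.isOpen (h.smooth a b) hx

theorem pd_comm (h : IsPseudoRiemannian U g) (hx : x ∈ U) (a b c : Fin n) :
    pd c (fun y => g y a b) x = pd c (fun y => g y b a) x :=
  pd_congr h.isOpen (fun y hy => (h.symm y hy).apply b a) hx c

theorem contDiffOn_gradient (h : IsPseudoRiemannian U g) (hf : ContDiffOn ℝ ∞ f U) (a : Fin n) :
    ContDiffOn ℝ ∞ (fun y => gradient g f y a) U :=
  ContDiffOn.sum fun b _ =>
    (contDiffOn_inv_apply h.smooth h.isUnit_det a b).mul (contDiffOn_pd h.isOpen hf b)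

theorem contDiffOn_christoffel (h : IsPseudoRiemannian U g) (a b c : Fin n) :
    ContDiffOn ℝ ∞ (christoffel g a b c) U := by
  refine contDiffOn_const.mul (ContDiffOn.sum fun d _ =>
    (contDiffOn_inv_apply h.smooth h.isUnit_det a d).mul ?_)
  have hpd (i j k : Fin n) := contDiffOn_pd h.isOpen (h.smooth i j) k
  exact ((hpd d c b).add (hpd d b c)).sub (hpd b c d)

theorem christoffel_comm (h : IsPseudoRiemannian U g) (hx : x ∈ U) (a b c : Fin n) :
    christoffel g a b c x = christoffel g a c b x := by
  unfold christoffel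
  refine congrArg _ (Finset.sum_congr rfl fun d _ => ?_)
  rw [h.pd_comm hx b c d]
  ring

theorem sum_metric_mul_christoffel (h : IsPseudoRiemannian U g) (hx : x ∈ U) (a b c : Fin n) :
    ∑ d, g x a d * christoffel g d b c x
      = 1 / 2 * (pd b (fun y => g y a c) x + pd c (fun y => g y a b) x
          - pd a (fun y => g y b c) x) := by
  let X : Fin n → ℝ := fun d =>
    pd b (fun y => g y d c) x + pd c (fun y => g y d b) x - pd d (fun y => g y b c) x
  calc ∑ d, g x a d * christoffel g d b c x
      = 1 / 2 * (g x).mulVec ((g x)⁻¹.mulVec X) a := by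
        rw [Matrix.mulVec, dotProduct, Finset.mul_sum]
        exact Finset.sum_congr rfl fun d _ => mul_left_comm _ _ _
    _ = 1 / 2 * X a := by
        rw [Matrix.mulVec_mulVec, Matrix.mul_nonsing_inv _ (h.isUnit_det x hx), Matrix.one_mulVec]

theorem pd_metric (h : IsPseudoRiemannian U g) (hx : x ∈ U) (a b c : Fin n) :
    pd a (fun y => g y b c) x
      = ∑ d, g x b d * christoffel g d a c x + ∑ d, g x c d * christoffel g d a b x := by
  rw [h.sum_metric_mul_christoffel hx, h.sum_metric_mul_christoffel hx, h.pd_comm hx c b,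
    h.pd_comm hx c a, h.pd_comm hx b a]
  ring

theorem pd_lower (h : IsPseudoRiemannian U g) (hv : ∀ a, ContDiffOn ℝ ∞ (fun y => v y a) U)
    (hx : x ∈ U) (a b : Fin n) :
    pd a (fun y => lower g v y b) x
      = ∑ d, (g x b d * pd a (fun y => v y d) x + pd a (fun y => g y b d) x * v x d) := by
  have hv' (d : Fin n) := differentiableAt_of_contDiffOn h.isOpen (hv d) hx
  unfold lower
  rw [pd_sum fun d _ => (h.differentiableAt hx b d).fun_mul (hv' d)]
  exact Finset.sum_congr rfl fun d _ => pd_mul (h.differentiableAt hx b d) (hv' d) a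

theorem sum_inv_mul_lower (h : IsPseudoRiemannian U g) (hx : x ∈ U) (a : Fin n) :
    ∑ b, (g x)⁻¹ a b * lower g v x b = v x a :=
  calc ∑ b, (g x)⁻¹ a b * lower g v x b = (g x)⁻¹.mulVec ((g x).mulVec (v x)) a := rfl
    _ = v x a := by
        rw [Matrix.mulVec_mulVec, Matrix.nonsing_inv_mul _ (h.isUnit_det x hx), Matrix.one_mulVec]

theorem sum_gradient_mul_lower (h : IsPseudoRiemannian U g) (hx : x ∈ U) :
    ∑ a, gradient g f x a * lower g v x a = along v f x := by
  have hinv : ((g x)⁻¹).IsSymm := (h.symm x hx).inv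
  simp only [gradient, Finset.sum_mul]
  rw [Finset.sum_comm]
  refine Finset.sum_congr rfl fun b _ => ?_
  rw [← h.sum_inv_mul_lower (v := v) hx b, Finset.sum_mul]
  refine Finset.sum_congr rfl fun a _ => ?_
  rw [hinv.apply b a]
  ring

theorem covDeriv_lower (h : IsPseudoRiemannian U g)
    (hv : ∀ a, ContDiffOn ℝ ∞ (fun y => v y a) U) (hx : x ∈ U) (a b : Fin n) :
    covDeriv g (lower g v) x a b = ∑ d, g x b d * vecCovDeriv g v x a d := by
  have hcancel : ∑ d, (∑ c, g x d c * christoffel g c a b x) * v x d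
      = ∑ c, christoffel g c a b x * lower g v x c := by
    simp only [lower, Finset.sum_mul, Finset.mul_sum]
    rw [Finset.sum_comm]
    refine Finset.sum_congr rfl fun c _ => Finset.sum_congr rfl fun d _ => ?_
    rw [(h.symm x hx).apply c d]
    ring
  have hswap : ∑ d, (∑ c, g x b c * christoffel g c a d x) * v x d
      = ∑ d, g x b d * ∑ c, christoffel g d a c x * v x c := by
    simp only [Finset.sum_mul, Finset.mul_sum]
    rw [Finset.sum_comm]
    exact Finset.sum_congr rfl fun c _ => Finset.sum_congr rfl fun d _ => by ring
  simp only [covDeriv, h.pd_lower hv hx, h.pd_metric hx a b, vecCovDeriv, add_mul, mul_add,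
    Finset.sum_add_distrib, hcancel, hswap]
  ring

theorem sum_inv_mul_covDeriv_lower (h : IsPseudoRiemannian U g)
    (hv : ∀ a, ContDiffOn ℝ ∞ (fun y => v y a) U) (hx : x ∈ U) :
    ∑ a, ∑ b, (g x)⁻¹ a b * covDeriv g (lower g v) x a b = divergence g v x := by
  refine Finset.sum_congr rfl fun a _ => ?_
  calc ∑ b, (g x)⁻¹ a b * covDeriv g (lower g v) x a b
      = (g x)⁻¹.mulVec ((g x).mulVec (vecCovDeriv g v x a)) a :=
        Finset.sum_congr rfl fun b _ => by rw [h.covDeriv_lower hv hx]; rfl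
    _ = vecCovDeriv g v x a a := by
        rw [Matrix.mulVec_mulVec, Matrix.nonsing_inv_mul _ (h.isUnit_det x hx), Matrix.one_mulVec]

theorem sum_mul_covDeriv_lower (h : IsPseudoRiemannian U g)
    (hv : ∀ a, ContDiffOn ℝ ∞ (fun y => v y a) U) (hx : x ∈ U) (a : Fin n) :
    ∑ b, w x b * covDeriv g (lower g v) x a b = ∑ b, vecCovDeriv g v x a b * lower g w x b := by
  simp only [h.covDeriv_lower hv hx, lower, Finset.mul_sum]
  rw [Finset.sum_comm]
  refine Finset.sum_congr rfl fun b _ => Finset.sum_congr rfl fun c _ => ?_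
  rw [(h.symm x hx).apply b c]
  ring

theorem pd_innerProd (h : IsPseudoRiemannian U g) (hv : ∀ a, ContDiffOn ℝ ∞ (fun y => v y a) U)
    (hw : ∀ a, ContDiffOn ℝ ∞ (fun y => w y a) U) (hx : x ∈ U) (a : Fin n) :
    pd a (innerProd g v w) x = ∑ b, w x b * covDeriv g (lower g v) x a b
      + ∑ b, v x b * covDeriv g (lower g w) x a b := by
  have hv' (b : Fin n) := differentiableAt_of_contDiffOn h.isOpen (hv b) hx
  have hw' (b : Fin n) : DifferentiableAt ℝ (fun y => lower g w y b) x :=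
    differentiableAt_of_contDiffOn h.isOpen
      (ContDiffOn.sum fun c _ => (h.smooth b c).mul (hw c)) hx
  have hleibniz : pd a (innerProd g v w) x
      = ∑ b, (v x b * pd a (fun y => lower g w y b) x
        + pd a (fun y => v y b) x * lower g w x b) := by
    rw [show innerProd g v w = fun y => ∑ b, v y b * lower g w y b from
      funext fun _ => innerProd_eq_sum_mul_lower, pd_sum fun b _ => (hv' b).fun_mul (hw' b)]
    exact Finset.sum_congr rfl fun b _ => pd_mul (hv' b) (hw' b) a
  have hcancel : ∑ b, (∑ c, christoffel g b a c x * v x c) * lower g w x b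
      = ∑ b, v x b * ∑ c, christoffel g c a b x * lower g w x c := by
    simp only [Finset.sum_mul, Finset.mul_sum]
    rw [Finset.sum_comm]
    exact Finset.sum_congr rfl fun b _ => Finset.sum_congr rfl fun c _ => by ring
  rw [hleibniz, h.sum_mul_covDeriv_lower hv hx]
  simp only [vecCovDeriv, covDeriv, add_mul, mul_sub, Finset.sum_add_distrib,
    Finset.sum_sub_distrib, hcancel]
  ring

theorem contraction_covDeriv_add_contraction_covDeriv (h : IsPseudoRiemannian U g)
    (hv : ∀ a, ContDiffOn ℝ ∞ (fun y => v y a) U) (hw : ∀ a, ContDiffOn ℝ ∞ (fun y => w y a) U)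
    {c : ℝ} (hvw : ∀ y ∈ U, innerProd g v w y = c) (hx : x ∈ U) (z : Fin n → ℝ) :
    contraction (covDeriv g (lower g v) x) z (w x)
      + contraction (covDeriv g (lower g w) x) z (v x) = 0 := by
  have hpd (a : Fin n) := (h.pd_innerProd hv hw hx a).symm.trans (pd_eq_zero h.isOpen hvw hx a)
  calc contraction (covDeriv g (lower g v) x) z (w x)
        + contraction (covDeriv g (lower g w) x) z (v x)
      = ∑ a, z a * (∑ b, w x b * covDeriv g (lower g v) x a b
          + ∑ b, v x b * covDeriv g (lower g w) x a b) := by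
        simp only [contraction, mul_add, Finset.mul_sum, ← Finset.sum_add_distrib]
        exact Finset.sum_congr rfl fun a _ => Finset.sum_congr rfl fun b _ => by ring
    _ = 0 := by simp only [hpd, mul_zero, Finset.sum_const_zero]

theorem contraction_covDeriv_eq_zero (h : IsPseudoRiemannian U g)
    (hv : ∀ a, ContDiffOn ℝ ∞ (fun y => v y a) U) {c : ℝ} (hvv : ∀ y ∈ U, innerProd g v v y = c)
    (hx : x ∈ U) (z : Fin n → ℝ) : contraction (covDeriv g (lower g v) x) z (v x) = 0 :=
  self_eq_neg.mp <|
    eq_neg_of_add_eq_zero_left (h.contraction_covDeriv_add_contraction_covDeriv hv hv hvv hx z)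

end IsPseudoRiemannian

end LeviCivita

section OrthonormalFrame

variable {U : Set (Coord 4)} {x : Coord 4} {g T : TensorField 4} {u e v : VecField 4}

/-- The trace `Nᵃᵇ S_ab` of a 2-tensor over the sheets orthogonal to `u` and `e`. -/
noncomputable def sheetTrace (g : TensorField 4) (u e : VecField 4) (x : Coord 4)
    (S : Fin 4 → Fin 4 → ℝ) : ℝ :=
  ∑ a, ∑ b, sheetUp g u e x a b * S a b

theorem sum_hUp_mul (S : Fin 4 → Fin 4 → ℝ) :
    ∑ a, ∑ b, hUp g u x a b * S a b
      = ∑ a, ∑ b, (g x)⁻¹ a b * S a b + contraction S (u x) (u x) := by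
  simp only [contraction, hUp, ← Finset.sum_add_distrib]
  exact Finset.sum_congr rfl fun a _ => Finset.sum_congr rfl fun b _ => by ring

theorem sheetTrace_eq_sub_contraction (S : Fin 4 → Fin 4 → ℝ) :
    sheetTrace g u e x S = ∑ a, ∑ b, hUp g u x a b * S a b - contraction S (e x) (e x) := by
  simp only [sheetTrace, contraction, sheetUp, ← Finset.sum_sub_distrib]
  exact Finset.sum_congr rfl fun a _ => Finset.sum_congr rfl fun b _ => by ring

theorem sum_mul_hMix {Y : Fin 4 → ℝ} (hY : ∑ b, Y b * lower g u x b = 0) (d : Fin 4) :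
    ∑ b, Y b * hMix g u x d b = Y d := by
  have hsplit : ∑ b, Y b * hMix g u x d b
      = ∑ b, (if d = b then Y b else 0) + u x d * ∑ b, Y b * lower g u x b := by
    rw [Finset.mul_sum, ← Finset.sum_add_distrib]
    refine Finset.sum_congr rfl fun b _ => ?_
    rw [hMix, mul_add, mul_ite, mul_one, mul_zero, mul_left_comm]
  rw [hsplit, hY, mul_zero, add_zero, Finset.sum_ite_eq, if_pos (Finset.mem_univ d)]

theorem sum_mul_projection {X : Fin 4 → Fin 4 → ℝ}
    (hleft : ∀ b, ∑ a, X a b * lower g u x a = 0) (hright : ∀ a, ∑ b, X a b * lower g u x b = 0)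
    (S : Fin 4 → Fin 4 → ℝ) :
    ∑ a, ∑ b, X a b * ∑ c, ∑ d, hMix g u x c a * hMix g u x d b * S c d
      = ∑ c, ∑ d, X c d * S c d := by
  have hsecond (a : Fin 4) : ∑ b, X a b * ∑ c, ∑ d, hMix g u x c a * hMix g u x d b * S c d
      = ∑ c, ∑ d, X a d * hMix g u x c a * S c d := by
    simp only [Finset.mul_sum]
    rw [Finset.sum_comm]
    refine Finset.sum_congr rfl fun c _ => ?_
    rw [Finset.sum_comm]
    refine Finset.sum_congr rfl fun d _ => ?_
    rw [← sum_mul_hMix (hright a) d, Finset.sum_mul, Finset.sum_mul]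
    exact Finset.sum_congr rfl fun b _ => by ring
  simp only [hsecond]
  rw [Finset.sum_comm]
  refine Finset.sum_congr rfl fun c _ => ?_
  rw [Finset.sum_comm]
  refine Finset.sum_congr rfl fun d _ => ?_
  rw [← Finset.sum_mul, sum_mul_hMix (hleft d) c]

theorem contraction_projection (hv : innerProd g v u x = 0) (S : Fin 4 → Fin 4 → ℝ) :
    contraction (fun a b => ∑ c, ∑ d, hMix g u x c a * hMix g u x d b * S c d) (v x) (v x)
      = contraction S (v x) (v x) := by
  rw [innerProd_eq_sum_mul_lower] at hv
  have hcomm (R : Fin 4 → Fin 4 → ℝ) :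
      contraction R (v x) (v x) = ∑ a, ∑ b, v x a * v x b * R a b :=
    Finset.sum_congr rfl fun a _ => Finset.sum_congr rfl fun b _ => by ring
  rw [hcomm, hcomm]
  refine sum_mul_projection (X := fun a b => v x a * v x b) (fun b => ?_) (fun a => ?_) S
  · simp only [mul_right_comm _ _ (lower g u x _), ← Finset.sum_mul, hv, zero_mul]
  · simp only [mul_assoc, ← Finset.mul_sum, hv, mul_zero]

/-- A smooth unit timelike field `u` and a smooth unit spacelike field `e` orthogonal to it: the
frame of the 1+1+2 formalism, with no symmetry assumed. -/
structure IsOrthonormalFrame (U : Set (Coord 4)) (g : TensorField 4) (u e : VecField 4) :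
    Prop where
  metric : IsPseudoRiemannian U g
  smooth_u : ∀ a, ContDiffOn ℝ ∞ (fun y => u y a) U
  smooth_e : ∀ a, ContDiffOn ℝ ∞ (fun y => e y a) U
  unit_u : ∀ y ∈ U, innerProd g u u y = -1
  unit_e : ∀ y ∈ U, innerProd g e e y = 1
  orthogonal : ∀ y ∈ U, innerProd g u e y = 0

namespace IsOrthonormalFrame

variable (h : IsOrthonormalFrame U g u e) (hx : x ∈ U)
include h hx

theorem orthogonal_symm : innerProd g e u x = 0 := by
  rw [innerProd_comm (h.metric.symm x hx), h.orthogonal x hx]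

theorem hUp_symm (a b : Fin 4) : hUp g u x a b = hUp g u x b a := by
  have hinv : ((g x)⁻¹).IsSymm := (h.metric.symm x hx).inv
  rw [hUp, hUp, hinv.apply, mul_comm (u x a)]

theorem sum_hUp_mul_lower (a : Fin 4) : ∑ b, hUp g u x a b * lower g u x b = 0 := by
  have huu := h.unit_u x hx
  rw [innerProd_eq_sum_mul_lower] at huu
  simp only [hUp, add_mul, Finset.sum_add_distrib, mul_assoc, ← Finset.mul_sum, huu,
    h.metric.sum_inv_mul_lower hx]
  ring

theorem sum_sheetUp_mul_lower (a : Fin 4) : ∑ b, sheetUp g u e x a b * lower g u x b = 0 := by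
  have heu := h.orthogonal_symm hx
  rw [innerProd_eq_sum_mul_lower] at heu
  simp only [sheetUp, sub_mul, Finset.sum_sub_distrib, mul_assoc, ← Finset.mul_sum, heu,
    h.sum_hUp_mul_lower hx]
  ring

theorem sum_hUp_mul_spatialDeriv (w : VecField 4) :
    ∑ a, ∑ b, hUp g u x a b * spatialDeriv g u w x a b
      = ∑ a, ∑ b, hUp g u x a b * covDeriv g w x a b :=
  sum_mul_projection (fun b => by simpa only [h.hUp_symm hx _ b] using h.sum_hUp_mul_lower hx b)
    (h.sum_hUp_mul_lower hx) _

theorem sheetTrace_spatialDeriv (w : VecField 4) :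
    sheetTrace g u e x (spatialDeriv g u w x) = sheetTrace g u e x (covDeriv g w x) := by
  have hsymm (a b : Fin 4) : sheetUp g u e x a b = sheetUp g u e x b a := by
    rw [sheetUp, sheetUp, h.hUp_symm hx, mul_comm (e x a)]
  exact sum_mul_projection
    (fun b => by simpa only [hsymm _ b] using h.sum_sheetUp_mul_lower hx b)
    (h.sum_sheetUp_mul_lower hx) _

theorem contraction_hLow : contraction (hLow g u x) (e x) (e x) = 1 := by
  have heu := h.orthogonal_symm hx
  rw [innerProd_eq_sum_mul_lower] at heu
  calc contraction (hLow g u x) (e x) (e x)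
      = innerProd g e e x + (∑ a, e x a * lower g u x a) * ∑ b, e x b * lower g u x b := by
        rw [Finset.sum_mul_sum]
        simp only [contraction, innerProd, hLow, ← Finset.sum_add_distrib]
        exact Finset.sum_congr rfl fun a _ => Finset.sum_congr rfl fun b _ => by ring
    _ = 1 := by rw [heu, h.unit_e x hx, mul_zero, add_zero]

theorem sum_hUp_mul_covDeriv : ∑ a, ∑ b, hUp g u x a b * covDeriv g (lower g u) x a b
    = divergence g u x := by
  rw [sum_hUp_mul, h.metric.sum_inv_mul_covDeriv_lower h.smooth_u hx,
    h.metric.contraction_covDeriv_eq_zero h.smooth_u h.unit_u hx, add_zero]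

theorem expansion_eq_divergence : expansion g u x = divergence g u x :=
  (h.sum_hUp_mul_spatialDeriv hx _).trans (h.sum_hUp_mul_covDeriv hx)

theorem acceleration_eq :
    acceleration g u e x = -contraction (covDeriv g (lower g e) x) (u x) (u x) := by
  rw [← eq_neg_of_add_eq_zero_left (h.metric.contraction_covDeriv_add_contraction_covDeriv
    h.smooth_u h.smooth_e h.orthogonal hx (u x)), contraction, acceleration]
  simp only [Finset.sum_mul]
  rw [Finset.sum_comm]
  exact Finset.sum_congr rfl fun a _ => Finset.sum_congr rfl fun b _ => by ring

theorem sheetExpansion_eq_sheetTrace :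
    sheetExpansion g u e x = sheetTrace g u e x (covDeriv g (lower g e) x) :=
  h.sheetTrace_spatialDeriv hx _

theorem sheetExpansion_add_acceleration :
    sheetExpansion g u e x + acceleration g u e x = divergence g e x := by
  rw [h.sheetExpansion_eq_sheetTrace hx, sheetTrace_eq_sub_contraction, sum_hUp_mul,
    h.metric.sum_inv_mul_covDeriv_lower h.smooth_e hx,
    h.metric.contraction_covDeriv_eq_zero h.smooth_e h.unit_e hx, h.acceleration_eq hx]
  ring

theorem shear_eq : shear g u e x
    = contraction (covDeriv g (lower g u) x) (e x) (e x) - 1 / 3 * expansion g u x := by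
  have hsplit : shear g u e x
      = contraction (fun a b => (spatialDeriv g u (lower g u) x a b
          + spatialDeriv g u (lower g u) x b a) / 2) (e x) (e x)
        - 1 / 3 * expansion g u x * contraction (hLow g u x) (e x) (e x) := by
    simp only [shear, shearTensor, contraction, sub_mul, mul_assoc, Finset.sum_sub_distrib,
      Finset.mul_sum]
  have hproj : contraction (spatialDeriv g u (lower g u) x) (e x) (e x)
      = contraction (covDeriv g (lower g u) x) (e x) (e x) :=
    contraction_projection (h.orthogonal_symm hx) _
  rw [hsplit, contraction_symmetrization, h.contraction_hLow hx, hproj, mul_one]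

theorem Psi_eq_neg_sheetTrace :
    Psi g u e x = -sheetTrace g u e x (covDeriv g (lower g u) x) := by
  rw [Psi, h.shear_eq hx, sheetTrace_eq_sub_contraction, h.sum_hUp_mul_covDeriv hx,
    ← h.expansion_eq_divergence hx]
  ring

theorem pressure_add_anisotropicPressure :
    pressure g T u x + anisotropicPressure g T u e x = contraction (T x) (e x) (e x) := by
  have hsplit : anisotropicPressure g T u e x
      = contraction (fun a b => ∑ c, ∑ d, hMix g u x c a * hMix g u x d b
          * ((T x c d + T x d c) / 2)) (e x) (e x)
        - pressure g T u x * contraction (hLow g u x) (e x) (e x) := by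
    simp only [anisotropicPressure, anisotropicStress, contraction, sub_mul, mul_assoc,
      Finset.sum_sub_distrib, Finset.mul_sum]
  rw [hsplit, h.contraction_hLow hx,
    contraction_projection (h.orthogonal_symm hx) fun c d => (T x c d + T x d c) / 2,
    contraction_symmetrization (T x)]
  ring

theorem sheetTrace_ricci (hT : EinsteinEquations U g T) :
    sheetTrace g u e x (ricci g x)
      = energyDensity T u x - pressure g T u x - anisotropicPressure g T u e x := by
  have hG : T x = einstein g x := Matrix.ext fun a b => (hT x hx a b).symm
  rw [sub_sub, h.pressure_add_anisotropicPressure hx,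
    show energyDensity T u x = contraction (T x) (u x) (u x) from rfl, hG,
    contraction_einstein, contraction_einstein, h.unit_u x hx, h.unit_e x hx,
    sheetTrace_eq_sub_contraction, sum_hUp_mul,
    show ∑ a, ∑ b, (g x)⁻¹ a b * ricci g x a b = scalarCurvature g x from rfl]
  ring

end IsOrthonormalFrame

end OrthonormalFrame

section SphereWarped

variable {n : ℕ} {θ ϕ : Fin n} {U : Set (Coord n)} {x : Coord n} {g : TensorField n}
  {q : Coord n → ℝ} {v : VecField n}

/-- A metric of the form `γ + q (dθ² + sin² θ dϕ²)` with `γ` and `q` independent of the polar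
coordinates `x θ`, `x ϕ` and `γ` without `dθ` or `dϕ` components: round spheres of radius `√q`
(pseudo-)orthogonal to a metric in the remaining coordinates. The invariance in `θ` omits the
components with an index `ϕ`, which are given by `metric_azimuthal`. -/
structure IsSphereWarped (θ ϕ : Fin n) (q : Coord n → ℝ) (U : Set (Coord n)) (g : TensorField n) :
    Prop extends IsPseudoRiemannian U g where
  polar_ne_azimuthal : θ ≠ ϕ
  sin_ne_zero : ∀ y ∈ U, sin (y θ) ≠ 0
  metric_polar : ∀ y ∈ U, ∀ b, g y b θ = if b = θ then q y else 0
  metric_azimuthal : ∀ y ∈ U, ∀ b, g y b ϕ = if b = ϕ then sin (y θ) ^ 2 * q y else 0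
  pd_polar : ∀ y ∈ U, ∀ a b, b ≠ ϕ → pd θ (fun z => g z a b) y = 0
  pd_azimuthal : ∀ y ∈ U, ∀ a b, pd ϕ (fun z => g z a b) y = 0

namespace IsSphereWarped

theorem metric_polar_polar (h : IsSphereWarped θ ϕ q U g) (hx : x ∈ U) : g x θ θ = q x := by
  rw [h.metric_polar x hx, if_pos rfl]

theorem contDiffOn_radiusSq (h : IsSphereWarped θ ϕ q U g) : ContDiffOn ℝ ∞ q U :=
  (h.smooth θ θ).congr fun _ hy => (h.metric_polar_polar hy).symm

theorem sum_pd_div_mul_gradient :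
    ∑ a, pd a q x / (2 * q x) * (gradient g q x a / 2) = along (gradient g q) q x / (4 * q x) := by
  rw [along, Finset.sum_div]
  exact Finset.sum_congr rfl fun a _ => by ring

variable (h : IsSphereWarped θ ϕ q U g) (hx : x ∈ U)
include h hx

theorem inv_polar_mul (c : Fin n) : (g x)⁻¹ c θ * q x = if c = θ then 1 else 0 :=
  calc (g x)⁻¹ c θ * q x = ∑ b, (g x)⁻¹ c b * g x b θ := by
        simp only [h.metric_polar x hx, mul_ite, mul_zero, Finset.sum_ite_eq', Finset.mem_univ,
          if_true]
    _ = ((g x)⁻¹ * g x) c θ := (Matrix.mul_apply ..).symm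
    _ = if c = θ then 1 else 0 := by
        rw [Matrix.nonsing_inv_mul _ (h.isUnit_det x hx), Matrix.one_apply]

theorem inv_azimuthal_mul (c : Fin n) :
    (g x)⁻¹ c ϕ * (sin (x θ) ^ 2 * q x) = if c = ϕ then 1 else 0 :=
  calc (g x)⁻¹ c ϕ * (sin (x θ) ^ 2 * q x) = ∑ b, (g x)⁻¹ c b * g x b ϕ := by
        simp only [h.metric_azimuthal x hx, mul_ite, mul_zero, Finset.sum_ite_eq',
          Finset.mem_univ, if_true]
    _ = ((g x)⁻¹ * g x) c ϕ := (Matrix.mul_apply ..).symm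
    _ = if c = ϕ then 1 else 0 := by
        rw [Matrix.nonsing_inv_mul _ (h.isUnit_det x hx), Matrix.one_apply]

theorem radiusSq_ne_zero : q x ≠ 0 := by
  intro hq
  simpa only [hq, mul_zero, if_true, zero_ne_one] using h.inv_polar_mul hx θ

theorem inv_polar (c : Fin n) : (g x)⁻¹ c θ = if c = θ then 1 / q x else 0 := by
  rw [eq_div_of_mul_eq (h.radiusSq_ne_zero hx) (h.inv_polar_mul hx c), ite_div, zero_div]

theorem inv_azimuthal (c : Fin n) :
    (g x)⁻¹ c ϕ = if c = ϕ then 1 / (sin (x θ) ^ 2 * q x) else 0 := by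
  have hne := mul_ne_zero (pow_ne_zero 2 (h.sin_ne_zero x hx)) (h.radiusSq_ne_zero hx)
  rw [eq_div_of_mul_eq hne (h.inv_azimuthal_mul hx c), ite_div, zero_div]

theorem pd_radiusSq_polar : pd θ q x = 0 := by
  rw [← pd_congr h.isOpen (fun _ => h.metric_polar_polar) hx,
    h.pd_polar x hx θ θ h.polar_ne_azimuthal]

theorem pd_radiusSq_azimuthal : pd ϕ q x = 0 := by
  rw [← pd_congr h.isOpen (fun _ => h.metric_polar_polar) hx, h.pd_azimuthal x hx]

theorem pd_metric_polar (b c : Fin n) :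
    pd c (fun y => g y b θ) x = if b = θ then pd c q x else 0 := by
  rw [pd_congr h.isOpen (fun y hy => h.metric_polar y hy b) hx]
  split_ifs
  exacts [rfl, pd_const 0 c]

theorem pd_metric_azimuthal (b c : Fin n) :
    pd c (fun y => g y b ϕ) x = if b = ϕ then sin (x θ) ^ 2 * pd c q x
      + (if c = θ then 2 * sin (x θ) * cos (x θ) * q x else 0) else 0 := by
  have hq := differentiableAt_of_contDiffOn h.isOpen h.contDiffOn_radiusSq hx
  have hsin : HasDerivAt (fun t => sin t ^ 2) (2 * sin (x θ) * cos (x θ)) (x θ) := by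
    simpa only [Nat.cast_ofNat, Nat.add_one_sub_one, pow_one]
      using (Real.hasDerivAt_sin (x θ)).fun_pow 2
  rw [pd_congr h.isOpen (fun y hy => h.metric_azimuthal y hy b) hx]
  split_ifs with hb hc
  · rw [pd_mul (f := fun y => sin (y θ) ^ 2) (by fun_prop) hq, pd_comp_coord hsin, if_pos hc]
  · rw [pd_mul (f := fun y => sin (y θ) ^ 2) (by fun_prop) hq, pd_comp_coord hsin, if_neg hc,
      zero_mul]
  · exact pd_const 0 c

theorem pd_polar_metric (a b : Fin n) : pd θ (fun y => g y a b) x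
    = if a = ϕ ∧ b = ϕ then 2 * sin (x θ) * cos (x θ) * q x else 0 := by
  by_cases hb : b = ϕ
  · subst hb
    simp only [h.pd_metric_azimuthal hx, h.pd_radiusSq_polar hx, mul_zero, zero_add, if_true,
      and_true]
  · rw [h.pd_polar x hx a b hb, if_neg fun hab => hb hab.2]

theorem gradient_radiusSq_polar : gradient g q x θ = 0 := by
  rw [gradient]
  refine Finset.sum_eq_zero fun b _ => ?_
  rw [(h.symm x hx).inv.apply, h.inv_polar hx]
  split_ifs with hb
  · rw [hb, h.pd_radiusSq_polar hx, mul_zero]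
  · exact zero_mul _

theorem gradient_radiusSq_azimuthal : gradient g q x ϕ = 0 := by
  rw [gradient]
  refine Finset.sum_eq_zero fun b _ => ?_
  rw [(h.symm x hx).inv.apply, h.inv_azimuthal hx]
  split_ifs with hb
  · rw [hb, h.pd_radiusSq_azimuthal hx, mul_zero]
  · exact zero_mul _

theorem christoffel_polar (c b : Fin n) :
    christoffel g c θ b x = (if c = ϕ ∧ b = ϕ then cos (x θ) / sin (x θ) else 0)
      + (if c = θ then pd b q x / (2 * q x) else 0)
      - (if b = θ then gradient g q x c / 2 else 0) := by
  have hsin := h.sin_ne_zero x hx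
  have hq := h.radiusSq_ne_zero hx
  have hlast (d : Fin n) : pd d (fun y => g y θ b) x = if b = θ then pd d q x else 0 := by
    rw [h.pd_comm hx, h.pd_metric_polar hx]
  have hsum : ∑ d, (g x)⁻¹ c d * (pd θ (fun y => g y d b) x + pd b (fun y => g y d θ) x
        - pd d (fun y => g y θ b) x)
      = (if b = ϕ then (g x)⁻¹ c ϕ * (2 * sin (x θ) * cos (x θ) * q x) else 0)
        + (g x)⁻¹ c θ * pd b q x - (if b = θ then gradient g q x c else 0) := by
    simp only [h.pd_polar_metric hx, h.pd_metric_polar hx, hlast, mul_sub, mul_add,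
      Finset.sum_sub_distrib, Finset.sum_add_distrib, ite_and, mul_ite, mul_zero,
      Finset.sum_ite_eq', Finset.mem_univ, if_true, gradient]
    split_ifs <;> simp
  rw [christoffel, hsum, h.inv_polar hx, h.inv_azimuthal hx]
  simp only [ite_and]
  split_ifs <;> field_simp <;> ring

theorem christoffel_azimuthal (c b : Fin n) :
    christoffel g c ϕ b x
      = (if c = ϕ then pd b q x / (2 * q x) + (if b = θ then cos (x θ) / sin (x θ) else 0) else 0)
        - (if b = ϕ then sin (x θ) ^ 2 * (gradient g q x c / 2)
            + (if c = θ then sin (x θ) * cos (x θ) else 0) else 0) := by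
  have hsin := h.sin_ne_zero x hx
  have hq := h.radiusSq_ne_zero hx
  have hlast (d : Fin n) : pd d (fun y => g y ϕ b) x = if b = ϕ then sin (x θ) ^ 2 * pd d q x
      + (if d = θ then 2 * sin (x θ) * cos (x θ) * q x else 0) else 0 := by
    rw [h.pd_comm hx, h.pd_metric_azimuthal hx]
  have hsum : ∑ d, (g x)⁻¹ c d * (pd ϕ (fun y => g y d b) x + pd b (fun y => g y d ϕ) x
        - pd d (fun y => g y ϕ b) x)
      = (g x)⁻¹ c ϕ * (sin (x θ) ^ 2 * pd b q x
          + if b = θ then 2 * sin (x θ) * cos (x θ) * q x else 0)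
        - if b = ϕ then sin (x θ) ^ 2 * gradient g q x c
          + (g x)⁻¹ c θ * (2 * sin (x θ) * cos (x θ) * q x) else 0 := by
    simp only [h.pd_azimuthal x hx, h.pd_metric_azimuthal hx, hlast, zero_add, mul_sub,
      Finset.sum_sub_distrib, mul_ite, mul_zero, Finset.sum_ite_eq', Finset.mem_univ, if_true]
    split_ifs <;> simp [mul_add, Finset.sum_add_distrib, gradient, Finset.mul_sum, mul_left_comm]
  rw [christoffel, hsum, h.inv_polar hx, h.inv_azimuthal hx]
  split_ifs <;> field_simp <;> ring

theorem christoffel_polar_polar (c : Fin n) :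
    christoffel g c θ θ x = -(1 / 2) * gradient g q x c := by
  simp only [h.christoffel_polar hx, h.pd_radiusSq_polar hx, h.polar_ne_azimuthal, and_false,
    if_false, if_true, zero_div, ite_self]
  ring

theorem christoffel_azimuthal_azimuthal (c : Fin n) :
    christoffel g c ϕ ϕ x = -(1 / 2) * (sin (x θ) ^ 2 * gradient g q x c)
      + -1 * if c = θ then sin (x θ) * cos (x θ) else 0 := by
  simp only [h.christoffel_azimuthal hx, h.pd_radiusSq_azimuthal hx, if_true,
    if_neg h.polar_ne_azimuthal.symm, zero_div, add_zero, ite_self]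
  ring

theorem sum_christoffel_polar : ∑ a, christoffel g a a θ x = cos (x θ) / sin (x θ) := by
  simp only [h.christoffel_comm hx _ _ θ, h.christoffel_polar hx, and_self,
    Finset.sum_add_distrib, Finset.sum_sub_distrib, Finset.sum_ite_eq', Finset.mem_univ, if_true,
    h.pd_radiusSq_polar hx, h.gradient_radiusSq_polar hx]
  ring

theorem sum_christoffel_azimuthal : ∑ a, christoffel g a a ϕ x = 0 := by
  simp only [h.christoffel_comm hx _ _ ϕ, h.christoffel_azimuthal hx,
    Finset.sum_sub_distrib, Finset.sum_ite_eq', Finset.mem_univ, if_true,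
    h.pd_radiusSq_azimuthal hx, h.gradient_radiusSq_azimuthal hx,
    if_neg h.polar_ne_azimuthal.symm]
  ring

theorem sum_christoffel_polar_mul_self :
    ∑ a, ∑ c, christoffel g a θ c x * christoffel g c a θ x
      = (cos (x θ) / sin (x θ)) ^ 2 - along (gradient g q) q x / (2 * q x) := by
  have hne := h.polar_ne_azimuthal
  have hgrad := sum_pd_div_mul_gradient (x := x) (g := g) (q := q)
  have hgrad' := hgrad
  simp only [mul_comm (pd _ q x / _)] at hgrad'
  simp only [h.christoffel_comm hx _ _ θ, h.christoffel_polar hx, add_mul, sub_mul, mul_add,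
    mul_sub, Finset.sum_add_distrib, Finset.sum_sub_distrib, ite_and, mul_ite, ite_mul, mul_zero,
    zero_mul, Finset.sum_ite_eq', Finset.mem_univ, if_true, hne, hne.symm, if_false,
    Finset.sum_const_zero, Finset.sum_ite_irrel, zero_div, h.pd_radiusSq_polar hx,
    h.pd_radiusSq_azimuthal hx, h.gradient_radiusSq_polar hx, h.gradient_radiusSq_azimuthal hx,
    hgrad, hgrad']
  ring

theorem sum_christoffel_azimuthal_mul_self :
    ∑ a, ∑ c, christoffel g a ϕ c x * christoffel g c a ϕ x
      = -(sin (x θ) ^ 2 * (along (gradient g q) q x / (2 * q x))) - 2 * cos (x θ) ^ 2 := by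
  have hne := h.polar_ne_azimuthal
  have hsin := h.sin_ne_zero x hx
  have hgrad := sum_pd_div_mul_gradient (x := x) (g := g) (q := q)
  have hgrad' := hgrad
  simp only [mul_comm (pd _ q x / _)] at hgrad'
  simp only [h.christoffel_comm hx _ _ ϕ, h.christoffel_azimuthal hx, add_mul, sub_mul, mul_add,
    mul_sub, Finset.sum_add_distrib, Finset.sum_sub_distrib, mul_ite, ite_mul, mul_zero,
    zero_mul, Finset.sum_ite_eq', Finset.mem_univ, if_true, hne, hne.symm, if_false,
    Finset.sum_const_zero, Finset.sum_ite_irrel, zero_div, h.pd_radiusSq_polar hx,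
    h.pd_radiusSq_azimuthal hx, h.gradient_radiusSq_polar hx, h.gradient_radiusSq_azimuthal hx,
    mul_left_comm _ (sin (x θ) ^ 2), mul_assoc (sin (x θ) ^ 2), ← Finset.mul_sum, hgrad, hgrad']
  field_simp
  ring

theorem ricci_polar : ricci g x θ θ
    = 1 - (divergence g (gradient g q) x - along (gradient g q) q x / q x) / 2 := by
  have hsin := h.sin_ne_zero x hx
  have hgrad (a : Fin n) : DifferentiableAt ℝ (fun y => gradient g q y a) x :=
    differentiableAt_of_contDiffOn h.isOpen (h.contDiffOn_gradient h.contDiffOn_radiusSq a) hx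
  have hdiv : divergence g (fun y a => christoffel g a θ θ y) x
      = -(1 / 2) * divergence g (gradient g q) x := by
    rw [divergence_congr h.isOpen (fun y hy => funext (h.christoffel_polar_polar hy)) hx,
      divergence_const_mul _ hgrad]
  have htrace : ∑ a, pd θ (christoffel g a a θ) x = -(1 / sin (x θ) ^ 2) := by
    rw [← pd_sum fun a _ => differentiableAt_of_contDiffOn h.isOpen
      (h.contDiffOn_christoffel a a θ) hx, pd_congr h.isOpen
      (fun y hy => h.sum_christoffel_polar hy) hx, pd_comp_coord (hasDerivAt_cos_div_sin hsin),
      if_pos rfl]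
  rw [ricci_eq_divergence_sub, hdiv, htrace, h.sum_christoffel_polar_mul_self hx]
  have hq := h.radiusSq_ne_zero hx
  field_simp
  linear_combination -2 * q x * Real.sin_sq_add_cos_sq (x θ)

theorem divergence_sin_mul_cos_polar : divergence g
    (fun y a => if a = θ then sin (y θ) * cos (y θ) else 0) x
      = 2 * cos (x θ) ^ 2 - sin (x θ) ^ 2 := by
  have hsin := h.sin_ne_zero x hx
  have hderiv : HasDerivAt (fun t => sin t * cos t)
      (cos (x θ) * cos (x θ) + sin (x θ) * -sin (x θ)) (x θ) :=
    (Real.hasDerivAt_sin _).mul (Real.hasDerivAt_cos _)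
  have hpd (a : Fin n) : pd a (fun y => if a = θ then sin (y θ) * cos (y θ) else 0) x
      = if a = θ then cos (x θ) ^ 2 - sin (x θ) ^ 2 else 0 := by
    split_ifs with ha
    · rw [pd_comp_coord hderiv, if_pos ha]
      ring
    · exact pd_const 0 a
  simp only [divergence, vecCovDeriv, hpd, mul_ite, mul_zero, Finset.sum_add_distrib,
    Finset.sum_ite_eq', Finset.mem_univ, if_true, ← Finset.sum_mul, h.sum_christoffel_polar hx]
  field_simp
  ring

theorem ricci_azimuthal : ricci g x ϕ ϕ = sin (x θ) ^ 2
    * (1 - (divergence g (gradient g q) x - along (gradient g q) q x / q x) / 2) := by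
  have hq := h.radiusSq_ne_zero hx
  have hgrad (a : Fin n) : DifferentiableAt ℝ (fun y => gradient g q y a) x :=
    differentiableAt_of_contDiffOn h.isOpen (h.contDiffOn_gradient h.contDiffOn_radiusSq a) hx
  have hdiv : divergence g (fun y a => christoffel g a ϕ ϕ y) x
      = -(sin (x θ) ^ 2 / 2) * divergence g (gradient g q) x
        - (2 * cos (x θ) ^ 2 - sin (x θ) ^ 2) := by
    have hsq : along (gradient g q) (fun y => sin (y θ) ^ 2) x = 0 := by
      rw [along_comp_coord ((Real.hasDerivAt_sin (x θ)).fun_pow 2),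
        h.gradient_radiusSq_polar hx, zero_mul]
    have hsinsq : DifferentiableAt ℝ (fun y : Coord n => sin (y θ) ^ 2) x := by fun_prop
    have hsincos (a : Fin n) : DifferentiableAt ℝ
        (fun y : Coord n => if a = θ then sin (y θ) * cos (y θ) else 0) x := by
      split_ifs <;> fun_prop
    rw [divergence_congr h.isOpen (fun y hy => funext (h.christoffel_azimuthal_azimuthal hy)) hx,
      divergence_add (fun a => (hsinsq.fun_mul (hgrad a)).const_mul _)
        (fun a => (hsincos a).const_mul _),
      divergence_const_mul _ fun a => hsinsq.fun_mul (hgrad a), divergence_const_mul _ hsincos,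
      divergence_mul hsinsq hgrad, hsq, h.divergence_sin_mul_cos_polar hx]
    ring
  have htrace : ∑ a, pd ϕ (christoffel g a a ϕ) x = 0 := by
    rw [← pd_sum fun a _ => differentiableAt_of_contDiffOn h.isOpen
      (h.contDiffOn_christoffel a a ϕ) hx, pd_eq_zero h.isOpen
      (fun y hy => h.sum_christoffel_azimuthal hy) hx]
  rw [ricci_eq_divergence_sub, hdiv, htrace, h.sum_christoffel_azimuthal_mul_self hx]
  field_simp
  ring

theorem lower_polar : lower g v x θ = q x * v x θ := by
  simp only [lower, (h.symm x hx).apply _ θ, h.metric_polar x hx, ite_mul, zero_mul,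
    Finset.sum_ite_eq', Finset.mem_univ, if_true]

theorem lower_azimuthal : lower g v x ϕ = sin (x θ) ^ 2 * q x * v x ϕ := by
  simp only [lower, (h.symm x hx).apply _ ϕ, h.metric_azimuthal x hx, ite_mul, zero_mul,
    Finset.sum_ite_eq', Finset.mem_univ, if_true]

theorem covDeriv_lower_polar (hv : ∀ y ∈ U, v y θ = 0) :
    covDeriv g (lower g v) x θ θ = along v q x / 2 := by
  have hlower (y : Coord n) (hy : y ∈ U) : lower g v y θ = 0 := by
    rw [h.lower_polar hy, hv y hy, mul_zero]
  simp only [covDeriv, pd_eq_zero h.isOpen hlower hx, h.christoffel_polar_polar hx, mul_assoc,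
    ← Finset.mul_sum, h.sum_gradient_mul_lower hx]
  ring

theorem covDeriv_lower_azimuthal (hvθ : ∀ y ∈ U, v y θ = 0) (hvϕ : ∀ y ∈ U, v y ϕ = 0) :
    covDeriv g (lower g v) x ϕ ϕ = sin (x θ) ^ 2 * (along v q x / 2) := by
  have hlowerθ : lower g v x θ = 0 := by
    rw [h.lower_polar hx, hvθ x hx, mul_zero]
  have hlowerϕ (y : Coord n) (hy : y ∈ U) : lower g v y ϕ = 0 := by
    rw [h.lower_azimuthal hy, hvϕ y hy, mul_zero]
  simp only [covDeriv, pd_eq_zero h.isOpen hlowerϕ hx, h.christoffel_azimuthal_azimuthal hx,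
    mul_assoc, add_mul, ite_mul, zero_mul, Finset.sum_add_distrib, ← Finset.mul_sum,
    h.sum_gradient_mul_lower hx, Finset.sum_ite_eq', Finset.mem_univ, if_true, hlowerθ, mul_zero]
  ring

theorem innerProd_polar :
    innerProd g v (fun _ => Pi.single θ 1) x = v x θ * q x := by
  simp only [innerProd_single, h.metric_polar x hx, mul_ite, mul_zero, Finset.sum_ite_eq',
    Finset.mem_univ, if_true]

theorem innerProd_azimuthal :
    innerProd g v (fun _ => Pi.single ϕ 1) x = v x ϕ * (sin (x θ) ^ 2 * q x) := by
  simp only [innerProd_single, h.metric_azimuthal x hx, mul_ite, mul_zero, Finset.sum_ite_eq',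
    Finset.mem_univ, if_true]

end IsSphereWarped

end SphereWarped

section Shells

variable {q : Coord 2 → ℝ} {V : Set (Coord 2)} {γ : TensorField 2} {y : Coord 2}

theorem IsSphereWarped.scalarCurvature_eq (h : IsSphereWarped 0 1 q V γ) (hy : y ∈ V) :
    scalarCurvature γ y = 2 / q y := by
  have hgrad : Set.EqOn (gradient γ q) (fun _ _ => 0) V := fun z hz => by
    funext a
    fin_cases a
    exacts [h.gradient_radiusSq_polar hz, h.gradient_radiusSq_azimuthal hz]
  have hdiv : divergence γ (gradient γ q) y = 0 := by
    rw [divergence_congr h.isOpen hgrad hy]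
    simp only [divergence, vecCovDeriv, pd_const, mul_zero, Finset.sum_const_zero, add_zero]
  have hnorm : along (gradient γ q) q y = 0 := by
    simp only [along, hgrad hy, zero_mul, Finset.sum_const_zero]
  have hq := h.radiusSq_ne_zero hy
  have hsin := h.sin_ne_zero y hy
  simp only [scalarCurvature, Fin.sum_univ_two, h.inv_polar hy, h.inv_azimuthal hy,
    h.ricci_polar hy, h.ricci_azimuthal hy, hdiv, hnorm, if_true, zero_ne_one, one_ne_zero,
    if_false]
  field_simp
  ring

/-- The inclusion of the shell through `x`, in its coordinates `(θ, ϕ)`, into the spacetime. -/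
def shellInclusion (x : Coord 4) (y : Coord 2) : Coord 4 := ![x 0, x 1, y 0, y 1]

variable {U : Set (Coord 4)} {x : Coord 4} {g : TensorField 4} {r : Coord 4 → ℝ}

theorem shellInclusion_self (x : Coord 4) : shellInclusion x ![x 2, x 3] = x := by
  ext i
  fin_cases i <;> rfl

theorem contDiff_shellInclusion (x : Coord 4) : ContDiff ℝ ∞ (shellInclusion x) := by
  refine contDiff_pi.mpr fun i => ?_
  fin_cases i
  exacts [contDiff_const, contDiff_const, contDiff_apply ℝ ℝ 0, contDiff_apply ℝ ℝ 1]

theorem fderiv_shellInclusion_single (x : Coord 4) (y : Coord 2) (a : Fin 2) :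
    fderiv ℝ (shellInclusion x) y (Pi.single a 1) = Pi.single (![2, 3] a) 1 := by
  ext i
  have hpd : fderiv ℝ (shellInclusion x) y (Pi.single a 1) i
      = pd a (fun z => shellInclusion x z i) y := by
    rw [pd, fderiv_apply ((contDiff_shellInclusion x).differentiable (by simp) y)]
    rfl
  rw [hpd]
  fin_cases i
  · exact (pd_const _ _).trans (by fin_cases a <;> rfl)
  · exact (pd_const _ _).trans (by fin_cases a <;> rfl)
  · exact (pd_coord _ _).trans (by fin_cases a <;> simp)
  · exact (pd_coord _ _).trans (by fin_cases a <;> simp)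

theorem pd_comp_shellInclusion {f : Coord 4 → ℝ} (hf : DifferentiableAt ℝ f (shellInclusion x y))
    (a : Fin 2) :
    pd a (fun z => f (shellInclusion x z)) y = pd (![2, 3] a) f (shellInclusion x y) := by
  rw [pd, fderiv_fun_comp y hf ((contDiff_shellInclusion x).differentiable (by simp) y),
    ContinuousLinearMap.comp_apply, fderiv_shellInclusion_single, pd]

theorem shellMetric_polar (h : IsSphereWarped 2 3 r U g) (hy : shellInclusion x y ∈ U)
    (b : Fin 2) : shellMetric g x y b 0 = if b = 0 then r (shellInclusion x y) else 0 := by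
  refine (h.metric_polar _ hy _).trans ?_
  fin_cases b <;> simp

theorem shellMetric_azimuthal (h : IsSphereWarped 2 3 r U g) (hy : shellInclusion x y ∈ U)
    (b : Fin 2) : shellMetric g x y b 1
      = if b = 1 then sin (y 0) ^ 2 * r (shellInclusion x y) else 0 := by
  refine (h.metric_azimuthal _ hy _).trans ?_
  fin_cases b <;> simp [shellInclusion]

theorem pd_shellMetric (h : IsPseudoRiemannian U g) (hy : shellInclusion x y ∈ U) (a b c : Fin 2) :
    pd c (fun z => shellMetric g x z a b) y
      = pd (![2, 3] c) (fun z => g z (![2, 3] a) (![2, 3] b)) (shellInclusion x y) :=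
  pd_comp_shellInclusion (h.differentiableAt hy _ _) c

theorem isPseudoRiemannian_shellMetric (h : IsSphereWarped 2 3 r U g) (x : Coord 4) :
    IsPseudoRiemannian (shellInclusion x ⁻¹' U) (shellMetric g x) where
  isOpen := h.isOpen.preimage (contDiff_shellInclusion x).continuous
  smooth a b := (h.smooth (![2, 3] a) (![2, 3] b)).comp
    (contDiff_shellInclusion x).contDiffOn fun _ hy => hy
  symm y hy := (h.symm _ hy).submatrix _
  isUnit_det y hy := by
    have hr := h.radiusSq_ne_zero hy
    have hsin : sin (y 0) ≠ 0 := h.sin_ne_zero (shellInclusion x y) hy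
    rw [Matrix.det_fin_two, shellMetric_polar h hy, shellMetric_azimuthal h hy,
      shellMetric_polar h hy, shellMetric_azimuthal h hy]
    simp [hr, hsin]

theorem isSphereWarped_shellMetric (h : IsSphereWarped 2 3 r U g) (x : Coord 4) :
    IsSphereWarped 0 1 (fun y => r (shellInclusion x y)) (shellInclusion x ⁻¹' U)
      (shellMetric g x) where
  toIsPseudoRiemannian := isPseudoRiemannian_shellMetric h x
  polar_ne_azimuthal := zero_ne_one
  sin_ne_zero y hy := h.sin_ne_zero (shellInclusion x y) hy
  metric_polar y hy := shellMetric_polar h hy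
  metric_azimuthal y hy := shellMetric_azimuthal h hy
  pd_polar y hy a b hb := by
    rw [pd_shellMetric h.toIsPseudoRiemannian hy]
    exact h.pd_polar _ hy _ _ (by fin_cases b <;> simp_all)
  pd_azimuthal y hy a b := by
    rw [pd_shellMetric h.toIsPseudoRiemannian hy]
    exact h.pd_azimuthal _ hy _ _

theorem IsSphereWarped.gaussCurvature_eq (h : IsSphereWarped 2 3 r U g) (hx : x ∈ U) :
    gaussCurvature g x = 1 / r x := by
  rw [gaussCurvature, (isSphereWarped_shellMetric h x).scalarCurvature_eq (y := ![x 2, x 3])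
    (by rwa [Set.mem_preimage, shellInclusion_self]), shellInclusion_self]
  ring

end Shells

section RotationGenerators

variable {x : Coord 4} {g : TensorField 4} {v : VecField 4}

theorem pd_rotation_shell (i : Fin 3) (c : Fin 4) :
    pd c (fun y => rotation i y 0) x = 0 ∧ pd c (fun y => rotation i y 1) x = 0 := by
  fin_cases i <;> exact ⟨pd_const 0 c, pd_const 0 c⟩

theorem pd_rotation_two (a c : Fin 4) : pd c (fun y => rotation 2 y a) x = 0 := by
  fin_cases a
  exacts [pd_const 0 c, pd_const 0 c, pd_const 0 c, pd_const 1 c]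

theorem pd_rotation_zero_polar (c : Fin 4) :
    pd c (fun y => rotation 0 y 2) x = (if c = 3 then 1 else 0) * -cos (x 3) := by
  rw [boole_mul]
  exact pd_comp_coord (Real.hasDerivAt_sin (x 3)).fun_neg c

theorem pd_rotation_one_polar (c : Fin 4) :
    pd c (fun y => rotation 1 y 2) x = (if c = 3 then 1 else 0) * -sin (x 3) := by
  rw [boole_mul]
  exact pd_comp_coord (Real.hasDerivAt_cos (x 3)) c

theorem pd_neg_cot_mul {F : ℝ → ℝ} {F' : ℝ} (hs : sin (x 2) ≠ 0) (hF : HasDerivAt F F' (x 3))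
    (c : Fin 4) :
    pd c (fun y => -(cos (y 2) / sin (y 2)) * F (y 3)) x
      = (if c = 2 then 1 else 0) * (F (x 3) / sin (x 2) ^ 2)
        - (if c = 3 then 1 else 0) * (cos (x 2) / sin (x 2) * F') := by
  have hcot := (hasDerivAt_cos_div_sin hs).fun_neg
  have hdcot : DifferentiableAt ℝ (fun y : Coord 4 => -(cos (y 2) / sin (y 2))) x :=
    hcot.differentiableAt.comp x (f := fun y : Coord 4 => y 2) (by fun_prop)
  have hdF : DifferentiableAt ℝ (fun y : Coord 4 => F (y 3)) x :=
    hF.differentiableAt.comp x (f := fun y : Coord 4 => y 3) (by fun_prop)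
  rw [pd_mul hdcot hdF, pd_comp_coord hF, pd_comp_coord (i := 2) hcot]
  split_ifs <;> ring

theorem pd_rotation_zero_azimuthal (hs : sin (x 2) ≠ 0) (c : Fin 4) :
    pd c (fun y => rotation 0 y 3) x
      = (if c = 2 then 1 else 0) * (cos (x 3) / sin (x 2) ^ 2)
        - (if c = 3 then 1 else 0) * (cos (x 2) / sin (x 2) * -sin (x 3)) :=
  pd_neg_cot_mul hs (Real.hasDerivAt_cos _) c

theorem pd_rotation_one_azimuthal (hs : sin (x 2) ≠ 0) (c : Fin 4) :
    pd c (fun y => rotation 1 y 3) x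
      = (if c = 2 then 1 else 0) * (sin (x 3) / sin (x 2) ^ 2)
        - (if c = 3 then 1 else 0) * (cos (x 2) / sin (x 2) * cos (x 3)) :=
  pd_neg_cot_mul hs (Real.hasDerivAt_sin _) c

theorem rotation_zero_eq (x : Coord 4) :
    rotation 0 x = ![0, 0, -sin (x 3), -(cos (x 2) / sin (x 2)) * cos (x 3)] := rfl

theorem rotation_one_eq (x : Coord 4) :
    rotation 1 x = ![0, 0, cos (x 3), -(cos (x 2) / sin (x 2)) * sin (x 3)] := rfl

theorem lieMetric_rotation (i : Fin 3) (a b : Fin 4) :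
    lieMetric (rotation i) g x a b
      = rotation i x 2 * pd 2 (fun y => g y a b) x + rotation i x 3 * pd 3 (fun y => g y a b) x
        + (g x 2 b * pd a (fun y => rotation i y 2) x + g x 3 b * pd a (fun y => rotation i y 3) x)
        + (g x a 2 * pd b (fun y => rotation i y 2) x
          + g x a 3 * pd b (fun y => rotation i y 3) x) := by
  have hrot : rotation i x 0 = 0 ∧ rotation i x 1 = 0 := by fin_cases i <;> exact ⟨rfl, rfl⟩
  simp only [lieMetric, Fin.sum_univ_four, pd_rotation_shell, hrot]
  ring

theorem lieVec_rotation (i : Fin 3) (a : Fin 4) :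
    lieVec (rotation i) v x a
      = rotation i x 2 * pd 2 (fun y => v y a) x + rotation i x 3 * pd 3 (fun y => v y a) x
        - ∑ c, v x c * pd c (fun y => rotation i y a) x := by
  have hrot : rotation i x 0 = 0 ∧ rotation i x 1 = 0 := by fin_cases i <;> exact ⟨rfl, rfl⟩
  simp only [lieVec, Finset.sum_sub_distrib, Fin.sum_univ_four, hrot]
  ring

theorem lieMetric_rotation_two (a b : Fin 4) :
    lieMetric (rotation 2) g x a b = pd 3 (fun y => g y a b) x := by
  have hrot : rotation 2 x 2 = 0 ∧ rotation 2 x 3 = 1 := ⟨rfl, rfl⟩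
  simp only [lieMetric_rotation, pd_rotation_two, hrot]
  ring

theorem lieVec_rotation_two (a : Fin 4) :
    lieVec (rotation 2) v x a = pd 3 (fun y => v y a) x := by
  have hrot : rotation 2 x 2 = 0 ∧ rotation 2 x 3 = 1 := ⟨rfl, rfl⟩
  simp only [lieVec_rotation, pd_rotation_two, hrot, mul_zero, Finset.sum_const_zero]
  ring

/- Rotating the generators `0` and `1` by the angle `ϕ` gives the fields that at `x` itself are
`∂_θ` and `-cot θ ∂_ϕ`; their derivatives at `x` no longer involve `ϕ`. -/

theorem cos_mul_lieMetric_sub_sin_mul_lieMetric (hs : sin (x 2) ≠ 0) (a b : Fin 4) :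
    cos (x 3) * lieMetric (rotation 1) g x a b - sin (x 3) * lieMetric (rotation 0) g x a b
      = pd 2 (fun y => g y a b) x - cos (x 2) / sin (x 2) *
          ((if a = 3 then 1 else 0) * g x 3 b + (if b = 3 then 1 else 0) * g x a 3) := by
  simp only [lieMetric_rotation, pd_rotation_zero_polar, pd_rotation_one_polar,
    pd_rotation_zero_azimuthal hs, pd_rotation_one_azimuthal hs]
  simp only [rotation_zero_eq, rotation_one_eq, Matrix.cons_val]
  linear_combination (pd 2 (fun y => g y a b) x - cos (x 2) / sin (x 2) *
    ((if a = 3 then 1 else 0) * g x 3 b + (if b = 3 then 1 else 0) * g x a 3)) *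
      Real.sin_sq_add_cos_sq (x 3)

theorem cos_mul_lieMetric_add_sin_mul_lieMetric (hs : sin (x 2) ≠ 0) (a b : Fin 4) :
    cos (x 3) * lieMetric (rotation 0) g x a b + sin (x 3) * lieMetric (rotation 1) g x a b
      = ((if a = 2 then 1 else 0) * g x 3 b + (if b = 2 then 1 else 0) * g x a 3) / sin (x 2) ^ 2
        - ((if a = 3 then 1 else 0) * g x 2 b + (if b = 3 then 1 else 0) * g x a 2)
        - cos (x 2) / sin (x 2) * pd 3 (fun y => g y a b) x := by
  simp only [lieMetric_rotation, pd_rotation_zero_polar, pd_rotation_one_polar,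
    pd_rotation_zero_azimuthal hs, pd_rotation_one_azimuthal hs]
  simp only [rotation_zero_eq, rotation_one_eq, Matrix.cons_val]
  linear_combination
    (((if a = 2 then 1 else 0) * g x 3 b + (if b = 2 then 1 else 0) * g x a 3) / sin (x 2) ^ 2
      - ((if a = 3 then 1 else 0) * g x 2 b + (if b = 3 then 1 else 0) * g x a 2)
      - cos (x 2) / sin (x 2) * pd 3 (fun y => g y a b) x) * Real.sin_sq_add_cos_sq (x 3)

theorem cos_mul_lieVec_polar_add_sin_mul_lieVec_polar :
    cos (x 3) * lieVec (rotation 0) v x 2 + sin (x 3) * lieVec (rotation 1) v x 2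
      = v x 3 - cos (x 2) / sin (x 2) * pd 3 (fun y => v y 2) x := by
  simp only [lieVec_rotation, pd_rotation_zero_polar, pd_rotation_one_polar, boole_mul,
    mul_ite, mul_zero, Finset.sum_ite_eq', Finset.mem_univ, if_true]
  simp only [rotation_zero_eq, rotation_one_eq, Matrix.cons_val]
  linear_combination (v x 3 - cos (x 2) / sin (x 2) * pd 3 (fun y => v y 2) x) *
    Real.sin_sq_add_cos_sq (x 3)

theorem cos_mul_lieVec_azimuthal_add_sin_mul_lieVec_azimuthal (hs : sin (x 2) ≠ 0) :
    cos (x 3) * lieVec (rotation 0) v x 3 + sin (x 3) * lieVec (rotation 1) v x 3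
      = -(v x 2 / sin (x 2) ^ 2) - cos (x 2) / sin (x 2) * pd 3 (fun y => v y 3) x := by
  simp only [lieVec_rotation, pd_rotation_zero_azimuthal hs, pd_rotation_one_azimuthal hs,
    mul_sub, Finset.sum_sub_distrib, boole_mul, mul_ite, mul_zero, Finset.sum_ite_eq',
    Finset.mem_univ, if_true]
  simp only [rotation_zero_eq, rotation_one_eq, Matrix.cons_val]
  linear_combination (-(v x 2 / sin (x 2) ^ 2) - cos (x 2) / sin (x 2) * pd 3 (fun y => v y 3) x) *
    Real.sin_sq_add_cos_sq (x 3)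

end RotationGenerators

section RotationInvariance

variable {U : Set (Coord 4)} {x : Coord 4} {g : TensorField 4} {v : VecField 4}

namespace RotationInvariantMetric

variable (h : RotationInvariantMetric U g) (hx : x ∈ U)
include h hx

theorem pd_azimuthal_eq_zero (a b : Fin 4) : pd 3 (fun y => g y a b) x = 0 := by
  rw [← lieMetric_rotation_two, h 2 x hx]

variable (hs : sin (x 2) ≠ 0)
include hs

theorem mixed_components (a b : Fin 4) :
    ((if a = 2 then 1 else 0) * g x 3 b + (if b = 2 then 1 else 0) * g x a 3) / sin (x 2) ^ 2
      = (if a = 3 then 1 else 0) * g x 2 b + (if b = 3 then 1 else 0) * g x a 2 := by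
  have htilt := cos_mul_lieMetric_add_sin_mul_lieMetric (g := g) hs a b
  rw [h 0 x hx, h 1 x hx, h.pd_azimuthal_eq_zero hx] at htilt
  linear_combination -htilt

variable (hsymm : (g x).IsSymm)
include hsymm

theorem polar_azimuthal_eq_zero : g x 3 2 = 0 := by
  have h22 := h.mixed_components hx hs 2 2
  simp only [hsymm.apply 3 2, Fin.reduceEq, if_true, if_false, one_mul, zero_mul, add_zero,
    div_eq_zero_iff, pow_ne_zero 2 hs, or_false] at h22
  linarith

theorem metric_polar (b : Fin 4) : g x b 2 = if b = 2 then g x 2 2 else 0 := by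
  by_cases hb2 : b = 2
  · rw [if_pos hb2, hb2]
  by_cases hb3 : b = 3
  · rw [hb3, h.polar_azimuthal_eq_zero hx hs hsymm, if_neg (by decide)]
  have hmixed := h.mixed_components hx hs b 3
  simp only [hb2, hb3, Fin.reduceEq, if_true, if_false, one_mul, zero_mul, add_zero, zero_add,
    zero_div] at hmixed
  rw [← hmixed, if_neg hb2]

theorem metric_azimuthal (b : Fin 4) :
    g x b 3 = if b = 3 then sin (x 2) ^ 2 * g x 2 2 else 0 := by
  by_cases hb2 : b = 2
  · rw [hb2, hsymm.apply, h.polar_azimuthal_eq_zero hx hs hsymm, if_neg (by decide)]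
  have hmixed := h.mixed_components hx hs b 2
  by_cases hb3 : b = 3
  · simp only [hb3, Fin.reduceEq, if_true, if_false, one_mul, zero_mul, add_zero, zero_add,
      div_eq_iff (pow_ne_zero 2 hs)] at hmixed
    rw [if_pos hb3, hb3, hmixed, mul_comm]
  · simpa [hb2, hb3, hs] using hmixed

theorem pd_polar_eq_zero (a b : Fin 4) (hb : b ≠ 3) : pd 2 (fun y => g y a b) x = 0 := by
  have hg3 : g x 3 b = 0 := by rw [hsymm.apply, h.metric_azimuthal hx hs hsymm, if_neg hb]
  have hmeridian := cos_mul_lieMetric_sub_sin_mul_lieMetric (g := g) hs a b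
  rw [h 0 x hx, h 1 x hx, hg3, if_neg hb] at hmeridian
  linear_combination -hmeridian

end RotationInvariantMetric

theorem RotationInvariantVec.azimuthal_eq_zero (h : RotationInvariantVec U v) (hx : x ∈ U) :
    v x 3 = 0 := by
  have htilt := cos_mul_lieVec_polar_add_sin_mul_lieVec_polar (v := v) (x := x)
  rw [← lieVec_rotation_two, h 0 x hx, h 1 x hx, h 2 x hx] at htilt
  linear_combination -htilt

theorem RotationInvariantVec.polar_eq_zero (h : RotationInvariantVec U v) (hx : x ∈ U)
    (hs : sin (x 2) ≠ 0) : v x 2 = 0 := by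
  have htilt := cos_mul_lieVec_azimuthal_add_sin_mul_lieVec_azimuthal (v := v) hs
  rw [← lieVec_rotation_two, h 0 x hx, h 1 x hx, h 2 x hx] at htilt
  have hdiv : v x 2 / sin (x 2) ^ 2 = 0 := by linear_combination htilt
  exact (div_eq_zero_iff.mp hdiv).resolve_right (pow_ne_zero 2 hs)

end RotationInvariance

section Signature

open scoped Matrix

variable {ι : Type*} [Fintype ι] {U : Set (Coord 4)} {x : Coord 4} {g : TensorField 4}
  {v w : VecField 4}

/- With `(s, a)` and `(t, b)` the time and space parts of two Minkowski vectors: a nonzero vector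
orthogonal to a timelike one is spacelike. -/
theorem sq_lt_sum_sq_of_sum_mul_eq {s t : ℝ} {a b : ι → ℝ} (ha : ∑ i, a i ^ 2 < s ^ 2)
    (hab : ∑ i, a i * b i = s * t) (hne : t ≠ 0 ∨ b ≠ 0) : t ^ 2 < ∑ i, b i ^ 2 := by
  have hs : 0 < s ^ 2 := (Finset.sum_nonneg fun i _ => sq_nonneg (a i)).trans_lt ha
  have hb : b ≠ 0 := by
    rintro rfl
    simp only [Pi.zero_apply, mul_zero, Finset.sum_const_zero, zero_eq_mul,
      sq_pos_iff.mp hs, false_or] at hab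
    exact hne.elim (· hab) (· rfl)
  obtain ⟨i, hi⟩ := Function.ne_iff.mp hb
  have hb_pos : 0 < ∑ i, b i ^ 2 :=
    Finset.sum_pos' (fun _ _ => sq_nonneg _) ⟨i, Finset.mem_univ i, sq_pos_of_ne_zero hi⟩
  refine lt_of_mul_lt_mul_left ?_ hs.le
  calc s ^ 2 * t ^ 2 = (∑ i, a i * b i) ^ 2 := by rw [hab, mul_pow]
    _ ≤ (∑ i, a i ^ 2) * ∑ i, b i ^ 2 := Finset.sum_mul_sq_le_sq_mul_sq _ a b
    _ < s ^ 2 * ∑ i, b i ^ 2 := mul_lt_mul_of_pos_right ha hb_pos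

theorem innerProd_eq_dotProduct : innerProd g v w x = v x ⬝ᵥ g x *ᵥ w x := by
  simp only [innerProd, dotProduct, Matrix.mulVec, Finset.mul_sum]
  exact Finset.sum_congr rfl fun a _ => Finset.sum_congr rfl fun b _ => by ring

namespace IsLorentzMetric

variable (h : IsLorentzMetric U g) (hx : x ∈ U)
include h hx

theorem isUnit_det : IsUnit (g x).det := by
  obtain ⟨P, -, hP⟩ := h.signature x hx
  have hdet := congr_arg Matrix.det hP
  rw [Matrix.det_mul, Matrix.det_mul, Matrix.det_diagonal, Fin.prod_univ_four] at hdet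
  refine isUnit_iff_ne_zero.mpr fun h0 => ?_
  simp [h0] at hdet

theorem innerProd_self_pos (hv : innerProd g v v x < 0) (hvw : innerProd g v w x = 0)
    (hw : w x ≠ 0) : 0 < innerProd g w w x := by
  obtain ⟨P, hPdet, hP⟩ := h.signature x hx
  have hminkowski (y z : Fin 4 → ℝ) : (P *ᵥ y) ⬝ᵥ g x *ᵥ (P *ᵥ z)
      = ∑ i : Fin 3, y i.succ * z i.succ - y 0 * z 0 := by
    have hpull : (P *ᵥ y) ⬝ᵥ g x *ᵥ (P *ᵥ z) = y ⬝ᵥ (P.transpose * g x * P) *ᵥ z := by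
      simp only [← Matrix.mulVec_mulVec, Matrix.dotProduct_mulVec, Matrix.vecMul_transpose]
    rw [hpull, hP]
    simp only [dotProduct, Matrix.mulVec_diagonal, Fin.sum_univ_succ (n := 3), Matrix.cons_val_zero,
      Matrix.cons_val_succ]
    have hone (i : Fin 3) : (![1, 1, 1] : Fin 3 → ℝ) i = 1 := by fin_cases i <;> rfl
    simp only [hone, one_mul]
    ring
  obtain ⟨y, hy⟩ := Matrix.mulVec_surjective_iff_isUnit.mpr
    ((Matrix.isUnit_iff_isUnit_det P).mpr hPdet) (v x)
  obtain ⟨z, hz⟩ := Matrix.mulVec_surjective_iff_isUnit.mpr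
    ((Matrix.isUnit_iff_isUnit_det P).mpr hPdet) (w x)
  rw [innerProd_eq_dotProduct, ← hy, hminkowski, ← sq, sub_neg] at hv
  rw [innerProd_eq_dotProduct, ← hy, ← hz, hminkowski, sub_eq_zero] at hvw
  rw [innerProd_eq_dotProduct, ← hz, hminkowski, ← sq, sub_pos]
  simp only [← sq] at hv ⊢
  refine sq_lt_sum_sq_of_sum_mul_eq hv hvw ?_
  by_contra! hne
  refine hw ?_
  rw [← hz, show z = 0 from funext (Fin.cases hne.1 (congr_fun hne.2)), Matrix.mulVec_zero]

end IsLorentzMetric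

end Signature

namespace IsSphericallySymmetric

variable {U : Set (Coord 4)} {x : Coord 4} {g : TensorField 4} {u e : VecField 4}

theorem isPseudoRiemannian (hS : IsSphericallySymmetric U g u e) : IsPseudoRiemannian U g where
  isOpen := hS.isOpen
  smooth := hS.lorentz.smooth
  symm := hS.lorentz.symm
  isUnit_det _ hy := hS.lorentz.isUnit_det hy

theorem isOrthonormalFrame (hS : IsSphericallySymmetric U g u e) :
    IsOrthonormalFrame U g u e where
  metric := hS.isPseudoRiemannian
  smooth_u := hS.smooth_u
  smooth_e := hS.smooth_e
  unit_u := hS.unit_u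
  unit_e := hS.unit_e
  orthogonal := hS.orthogonal

theorem sin_ne_zero (hS : IsSphericallySymmetric U g u e) (hx : x ∈ U) : sin (x 2) ≠ 0 :=
  (Real.sin_pos_of_pos_of_lt_pi (hS.polar x hx).1 (hS.polar x hx).2).ne'

theorem isSphereWarped (hS : IsSphericallySymmetric U g u e) :
    IsSphereWarped 2 3 (fun y => g y 2 2) U g where
  toIsPseudoRiemannian := hS.isPseudoRiemannian
  polar_ne_azimuthal := by decide
  sin_ne_zero _ hy := hS.sin_ne_zero hy
  metric_polar y hy :=
    hS.invariant_metric.metric_polar hy (hS.sin_ne_zero hy) (hS.lorentz.symm y hy)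
  metric_azimuthal y hy :=
    hS.invariant_metric.metric_azimuthal hy (hS.sin_ne_zero hy) (hS.lorentz.symm y hy)
  pd_polar y hy :=
    hS.invariant_metric.pd_polar_eq_zero hy (hS.sin_ne_zero hy) (hS.lorentz.symm y hy)
  pd_azimuthal _ hy := hS.invariant_metric.pd_azimuthal_eq_zero hy

theorem metric_polar_polar_pos (hS : IsSphericallySymmetric U g u e) (hx : x ∈ U) :
    0 < g x 2 2 := by
  have hwarped := hS.isSphereWarped
  have horth : innerProd g u (fun _ => Pi.single 2 1) x = 0 := by
    rw [hwarped.innerProd_polar hx, hS.invariant_u.polar_eq_zero hx (hS.sin_ne_zero hx), zero_mul]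
  have hpos := hS.lorentz.innerProd_self_pos hx ((hS.unit_u x hx).trans_lt neg_one_lt_zero) horth
    (Pi.single_ne_zero_iff.mpr one_ne_zero)
  rwa [hwarped.innerProd_polar hx, Pi.single_eq_same, one_mul] at hpos

end IsSphericallySymmetric

section RadialFrame

variable {U : Set (Coord 4)} {x : Coord 4} {g T : TensorField 4} {u e v : VecField 4}
  {q : Coord 4 → ℝ}

/-- The tetrad `(u, e, ∂_θ, ∂_ϕ)` adapted to the polar coordinates of the shells. -/
def tetrad (u e : VecField 4) : Fin 4 → VecField 4 :=
  ![u, e, fun _ => Pi.single 2 1, fun _ => Pi.single 3 1]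

/-- The scalar squares of the tetrad `(u, e, ∂_θ, ∂_ϕ)` on spheres of area radius `√q`. -/
noncomputable def tetradSq (q : Coord 4 → ℝ) (x : Coord 4) : Fin 4 → ℝ :=
  ![-1, 1, q x, sin (x 2) ^ 2 * q x]

/-- The 1+1+2 frame of a spherically symmetric spacetime: an orthonormal pair `u`, `e` orthogonal
to the round spheres of area radius `√q`. -/
structure IsRadialFrame (q : Coord 4 → ℝ) (U : Set (Coord 4)) (g : TensorField 4)
    (u e : VecField 4) : Prop extends IsOrthonormalFrame U g u e where
  warped : IsSphereWarped 2 3 q U g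
  radiusSq_pos : ∀ y ∈ U, 0 < q y
  u_polar : ∀ y ∈ U, u y 2 = 0
  u_azimuthal : ∀ y ∈ U, u y 3 = 0
  e_polar : ∀ y ∈ U, e y 2 = 0
  e_azimuthal : ∀ y ∈ U, e y 3 = 0

namespace IsRadialFrame

variable (h : IsRadialFrame q U g u e) (hx : x ∈ U)
include h

theorem contDiffOn_radiusSq : ContDiffOn ℝ ∞ q U := h.warped.contDiffOn_radiusSq

theorem contDiffOn_along_u : ContDiffOn ℝ ∞ (along u q) U :=
  contDiffOn_along h.metric.isOpen h.smooth_u h.contDiffOn_radiusSq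

theorem contDiffOn_along_e : ContDiffOn ℝ ∞ (along e q) U :=
  contDiffOn_along h.metric.isOpen h.smooth_e h.contDiffOn_radiusSq

include hx

theorem radiusSq_ne_zero : q x ≠ 0 := (h.radiusSq_pos x hx).ne'

theorem innerProd_tetrad (i j : Fin 4) :
    innerProd g (tetrad u e i) (tetrad u e j) x = if i = j then tetradSq q x i else 0 := by
  have hcomm (v w : VecField 4) : innerProd g v w x = innerProd g w v x :=
    innerProd_comm (h.metric.symm x hx)
  have hpolar (v : VecField 4) := h.warped.innerProd_polar (v := v) hx
  have hazimuthal (v : VecField 4) := h.warped.innerProd_azimuthal (v := v) hx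
  fin_cases i <;> fin_cases j <;>
    simp [tetrad, tetradSq, h.unit_u x hx, h.unit_e x hx, h.orthogonal x hx,
      h.orthogonal_symm hx, hpolar, hazimuthal, hcomm (fun _ => Pi.single _ _) u,
      hcomm (fun _ => Pi.single _ _) e, h.u_polar x hx, h.u_azimuthal x hx, h.e_polar x hx,
      h.e_azimuthal x hx]

theorem tetradSq_ne_zero (i : Fin 4) : tetradSq q x i ≠ 0 := by
  have hs := pow_ne_zero 2 (h.warped.sin_ne_zero x hx)
  fin_cases i
  exacts [neg_ne_zero.mpr one_ne_zero, one_ne_zero, h.radiusSq_ne_zero hx,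
    mul_ne_zero hs (h.radiusSq_ne_zero hx)]

theorem sheetTrace_eq (S : Fin 4 → Fin 4 → ℝ) :
    sheetTrace g u e x S = S 2 2 / q x + S 3 3 / (sin (x 2) ^ 2 * q x) := by
  rw [sheetTrace_eq_sub_contraction, sum_hUp_mul,
    sum_inv_mul_eq_sum_of_orthogonal (h.innerProd_tetrad hx) (h.tetradSq_ne_zero hx),
    Fin.sum_univ_four]
  simp only [tetrad, tetradSq, Matrix.cons_val, contraction_single]
  ring

theorem gradient_radiusSq (a : Fin 4) :
    gradient g q x a = -along u q x * u x a + along e q x * e x a := by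
  rw [gradient_eq_sum_of_orthogonal (h.innerProd_tetrad hx) (h.tetradSq_ne_zero hx),
    Fin.sum_univ_four]
  simp only [tetrad, tetradSq, Matrix.cons_val, along_single, h.warped.pd_radiusSq_polar hx,
    h.warped.pd_radiusSq_azimuthal hx]
  ring

theorem along_gradient_radiusSq :
    along (gradient g q) q x = along e q x ^ 2 - along u q x ^ 2 := by
  simp only [along.eq_1 (gradient g q), h.gradient_radiusSq hx, add_mul, mul_assoc,
    Finset.sum_add_distrib, ← Finset.mul_sum]
  simp only [← along.eq_1]
  ring

theorem divergence_gradient_radiusSq :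
    divergence g (gradient g q) x
      = along e (along e q) x - along u (along u q) x
        + (sheetExpansion g u e x + acceleration g u e x) * along e q x
        - expansion g u x * along u q x := by
  have hU := h.metric.isOpen
  have hu (a : Fin 4) := differentiableAt_of_contDiffOn hU (h.smooth_u a) hx
  have he (a : Fin 4) := differentiableAt_of_contDiffOn hU (h.smooth_e a) hx
  have hqu : DifferentiableAt ℝ (fun y => -along u q y) x :=
    (differentiableAt_of_contDiffOn hU h.contDiffOn_along_u hx).fun_neg
  have hqe := differentiableAt_of_contDiffOn hU h.contDiffOn_along_e hx
  rw [divergence_congr hU (fun y hy => funext (h.gradient_radiusSq hy)) hx,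
    divergence_add (fun a => hqu.fun_mul (hu a)) (fun a => hqe.fun_mul (he a)),
    divergence_mul hqu hu, divergence_mul hqe he, along_neg, ← h.expansion_eq_divergence hx,
    ← h.sheetExpansion_add_acceleration hx]
  ring

theorem Psi_mul_radiusSq : Psi g u e x * q x = -along u q x := by
  have hq := h.radiusSq_ne_zero hx
  have hs := h.warped.sin_ne_zero x hx
  rw [h.Psi_eq_neg_sheetTrace hx, h.sheetTrace_eq hx, h.warped.covDeriv_lower_polar hx h.u_polar,
    h.warped.covDeriv_lower_azimuthal hx h.u_polar h.u_azimuthal]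
  field_simp
  ring

theorem sheetExpansion_mul_radiusSq : sheetExpansion g u e x * q x = along e q x := by
  have hq := h.radiusSq_ne_zero hx
  have hs := h.warped.sin_ne_zero x hx
  rw [h.sheetExpansion_eq_sheetTrace hx, h.sheetTrace_eq hx,
    h.warped.covDeriv_lower_polar hx h.e_polar,
    h.warped.covDeriv_lower_azimuthal hx h.e_polar h.e_azimuthal]
  field_simp
  ring

theorem sheetTrace_ricci_mul_radiusSq : sheetTrace g u e x (ricci g x) * q x
    = 2 - divergence g (gradient g q) x + along (gradient g q) q x / q x := by
  have hq := h.radiusSq_ne_zero hx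
  have hs := h.warped.sin_ne_zero x hx
  rw [h.sheetTrace_eq hx, h.warped.ricci_polar hx, h.warped.ricci_azimuthal hx]
  field_simp
  ring

omit hx in
theorem contDiffOn_Psi : ContDiffOn ℝ ∞ (Psi g u e) U :=
  (h.contDiffOn_along_u.neg.div h.contDiffOn_radiusSq fun _ => h.radiusSq_ne_zero).congr
    fun _ hy => eq_div_of_mul_eq (h.radiusSq_ne_zero hy) (h.Psi_mul_radiusSq hy)

omit hx in
theorem contDiffOn_sheetExpansion : ContDiffOn ℝ ∞ (sheetExpansion g u e) U :=
  (h.contDiffOn_along_e.div h.contDiffOn_radiusSq fun _ => h.radiusSq_ne_zero).congr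
    fun _ hy => eq_div_of_mul_eq (h.radiusSq_ne_zero hy) (h.sheetExpansion_mul_radiusSq hy)

omit hx in
theorem contDiffOn_gaussCurvature : ContDiffOn ℝ ∞ (gaussCurvature g) U :=
  (contDiffOn_const.div h.contDiffOn_radiusSq fun _ => h.radiusSq_ne_zero).congr
    fun _ => h.warped.gaussCurvature_eq

theorem gaussCurvature_pos : 0 < gaussCurvature g x := by
  rw [h.warped.gaussCurvature_eq hx]
  exact one_div_pos.mpr (h.radiusSq_pos x hx)

theorem along_gaussCurvature (v : VecField 4) :
    along v (gaussCurvature g) x = -along v q x / q x * gaussCurvature g x := by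
  have hU := h.metric.isOpen
  rw [along_congr hU (fun _ => h.warped.gaussCurvature_eq) hx, h.warped.gaussCurvature_eq hx]
  simp only [one_div]
  rw [along_comp (hasDerivAt_inv (h.radiusSq_ne_zero hx))
    (differentiableAt_of_contDiffOn hU h.contDiffOn_radiusSq hx)]
  field_simp

theorem along_u_gaussCurvature :
    along u (gaussCurvature g) x = Psi g u e x * gaussCurvature g x := by
  rw [h.along_gaussCurvature hx, ← h.Psi_mul_radiusSq hx,
    mul_div_cancel_right₀ _ (h.radiusSq_ne_zero hx)]

theorem along_e_gaussCurvature :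
    along e (gaussCurvature g) x = -sheetExpansion g u e x * gaussCurvature g x := by
  rw [h.along_gaussCurvature hx, ← h.sheetExpansion_mul_radiusSq hx, ← neg_mul,
    mul_div_cancel_right₀ _ (h.radiusSq_ne_zero hx)]

theorem wave_equation_gaussCurvature :
    along u (along u (gaussCurvature g)) x - along e (along e (gaussCurvature g)) x
      + restorationFactor g u e x * gaussCurvature g x = 0 := by
  have hU := h.metric.isOpen
  have hK := differentiableAt_of_contDiffOn hU h.contDiffOn_gaussCurvature hx
  have hΨ := differentiableAt_of_contDiffOn hU h.contDiffOn_Psi hx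
  have hφ := differentiableAt_of_contDiffOn hU h.contDiffOn_sheetExpansion hx
  rw [along_along_of_along_eq_mul hU hΨ hK (fun _ => h.along_u_gaussCurvature) hx,
    along_along_of_along_eq_mul hU hφ.fun_neg hK (fun _ => h.along_e_gaussCurvature) hx,
    along_neg, restorationFactor]
  ring

theorem along_along_radiusSq_sub :
    along u (along u q) x - along e (along e q) x
      = (restorationFactor g u e x + 2 * Psi g u e x ^ 2 - 2 * sheetExpansion g u e x ^ 2)
        * q x := by
  have hU := h.metric.isOpen
  have hq := differentiableAt_of_contDiffOn hU h.contDiffOn_radiusSq hx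
  have hΨ := differentiableAt_of_contDiffOn hU h.contDiffOn_Psi hx
  have hφ := differentiableAt_of_contDiffOn hU h.contDiffOn_sheetExpansion hx
  have hu : ∀ y ∈ U, along u q y = -Psi g u e y * q y := fun y hy => by
    rw [neg_mul, h.Psi_mul_radiusSq hy, neg_neg]
  have he : ∀ y ∈ U, along e q y = sheetExpansion g u e y * q y := fun y hy =>
    (h.sheetExpansion_mul_radiusSq hy).symm
  rw [along_along_of_along_eq_mul hU hΨ.fun_neg hq hu hx,
    along_along_of_along_eq_mul hU hφ hq he hx, along_neg, restorationFactor]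
  ring

omit hx in
theorem areaRadius_eqOn : Set.EqOn (areaRadius g) (fun y => √(q y)) U := fun y hy => by
  rw [areaRadius, h.warped.gaussCurvature_eq hy, Real.sqrt_div one_pos.le, Real.sqrt_one,
    one_div_one_div]

theorem misnerSharpMass_eq :
    misnerSharpMass g x = √(q x) / 2 * (1 - along (gradient g q) q x / (4 * q x)) := by
  have hpd (a : Fin 4) : pd a (areaRadius g) x = 1 / (2 * √(q x)) * pd a q x := by
    rw [pd_congr h.metric.isOpen h.areaRadius_eqOn hx, pd_comp
      (Real.hasDerivAt_sqrt (h.radiusSq_ne_zero hx))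
      (differentiableAt_of_contDiffOn h.metric.isOpen h.contDiffOn_radiusSq hx)]
  have hgrad : ∑ a, ∑ b, (g x)⁻¹ a b * pd a (areaRadius g) x * pd b (areaRadius g) x
      = along (gradient g q) q x / (4 * √(q x) ^ 2) := by
    simp only [hpd, along, gradient, Finset.sum_mul, Finset.sum_div]
    exact Finset.sum_congr rfl fun a _ => Finset.sum_congr rfl fun b _ => by ring
  rw [misnerSharpMass, hgrad, h.areaRadius_eqOn hx, Real.sq_sqrt (h.radiusSq_pos x hx).le]

theorem misnerSharpMass_mul_gaussCurvature_rpow :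
    16 * misnerSharpMass g x * gaussCurvature g x ^ (3 / 2 : ℝ)
      = 8 * gaussCurvature g x - 2 * (sheetExpansion g u e x ^ 2 - Psi g u e x ^ 2) := by
  have hq := h.radiusSq_pos x hx
  have hsqrt : √(q x) * (1 / q x) ^ (3 / 2 : ℝ) = 1 / q x := by
    rw [Real.sqrt_eq_rpow, Real.div_rpow one_pos.le hq.le, Real.one_rpow, mul_one_div,
      ← Real.rpow_sub hq, show (1 / 2 - 3 / 2 : ℝ) = -1 by norm_num, Real.rpow_neg_one, one_div]
  have hgrad : along (gradient g q) q x
      = (sheetExpansion g u e x ^ 2 - Psi g u e x ^ 2) * q x ^ 2 := by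
    rw [h.along_gradient_radiusSq hx, ← h.sheetExpansion_mul_radiusSq hx,
      ← neg_sq (along u q x), ← h.Psi_mul_radiusSq hx]
    ring
  calc 16 * misnerSharpMass g x * gaussCurvature g x ^ (3 / 2 : ℝ)
      = 8 * (1 - along (gradient g q) q x / (4 * q x))
          * (√(q x) * (1 / q x) ^ (3 / 2 : ℝ)) := by
        rw [h.misnerSharpMass_eq hx, h.warped.gaussCurvature_eq hx]
        ring
    _ = _ := by
        rw [hsqrt, hgrad, h.warped.gaussCurvature_eq hx]
        field_simp
        ring

theorem restorationFactor_eq (hT : EinsteinEquations U g T) :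
    restorationFactor g u e x
      = 6 * gaussCurvature g x
        - 16 * misnerSharpMass g x * gaussCurvature g x ^ (3 / 2 : ℝ)
        + Psi g u e x ^ 2 + Psi g u e x * expansion g u x
        + acceleration g u e x * sheetExpansion g u e x
        + energyDensity T u x - pressure g T u x - anisotropicPressure g T u e x := by
  have hq := h.radiusSq_ne_zero hx
  have hu : along u q x = -Psi g u e x * q x := by
    rw [neg_mul, h.Psi_mul_radiusSq hx, neg_neg]
  have hricci := h.sheetTrace_ricci_mul_radiusSq hx
  rw [h.sheetTrace_ricci hx hT, h.divergence_gradient_radiusSq hx, h.along_gradient_radiusSq hx,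
    ← h.sheetExpansion_mul_radiusSq hx, hu] at hricci
  rw [h.misnerSharpMass_mul_gaussCurvature_rpow hx, h.warped.gaussCurvature_eq hx]
  have hwave := h.along_along_radiusSq_sub hx
  field_simp at hricci ⊢
  linear_combination -hwave - hricci

end IsRadialFrame

theorem IsSphericallySymmetric.isRadialFrame (hS : IsSphericallySymmetric U g u e) :
    IsRadialFrame (fun y => g y 2 2) U g u e where
  toIsOrthonormalFrame := hS.isOrthonormalFrame
  warped := hS.isSphereWarped
  radiusSq_pos _ := hS.metric_polar_polar_pos
  u_polar _ hy := hS.invariant_u.polar_eq_zero hy (hS.sin_ne_zero hy)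
  u_azimuthal _ := hS.invariant_u.azimuthal_eq_zero
  e_polar _ hy := hS.invariant_e.polar_eq_zero hy (hS.sin_ne_zero hy)
  e_azimuthal _ := hS.invariant_e.azimuthal_eq_zero

end RadialFrame

end SphericalSpacetime

theorem mainTheorem1 (U : Set (Coord 4)) (g T : TensorField 4) (u e : VecField 4)
    (hS : IsSphericallySymmetric U g u e) (hT : EinsteinEquations U g T) :
    ContDiffOn ℝ ∞ (gaussCurvature g) U ∧
    ContDiffOn ℝ ∞ (Psi g u e) U ∧
    ContDiffOn ℝ ∞ (sheetExpansion g u e) U ∧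
    ∀ x ∈ U,
      0 < gaussCurvature g x ∧
      along u (gaussCurvature g) x
        = (shear g u e x - 2 / 3 * expansion g u x) * gaussCurvature g x ∧
      along e (gaussCurvature g) x = -sheetExpansion g u e x * gaussCurvature g x ∧
      along u (along u (gaussCurvature g)) x - along e (along e (gaussCurvature g)) x
        + restorationFactor g u e x * gaussCurvature g x = 0 ∧
      restorationFactor g u e x
        = 6 * gaussCurvature g x
          - 16 * misnerSharpMass g x * gaussCurvature g x ^ (3 / 2 : ℝ)
          + Psi g u e x ^ 2 + Psi g u e x * expansion g u x
          + acceleration g u e x * sheetExpansion g u e x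
          + energyDensity T u x - pressure g T u x - anisotropicPressure g T u e x := by
  have h := hS.isRadialFrame
  exact ⟨h.contDiffOn_gaussCurvature, h.contDiffOn_Psi, h.contDiffOn_sheetExpansion, fun x hx =>
    ⟨h.gaussCurvature_pos hx, h.along_u_gaussCurvature hx, h.along_e_gaussCurvature hx,
      h.wave_equation_gaussCurvature hx, h.restorationFactor_eq hx hT⟩⟩
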